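/- Let $\mathbb C^7=\operatorname{Im}(\mathbb O)\otimes\mathbb C$ carry the complex bilinear extension $\langle x,y\rangle=\sum_i x_iy_i$ of the standard inner product and coordinatewise conjugation, both with respect to the imaginary units $e_1,\dots,e_7$. Let $^\perp$ denote the orthogonal complement with respect to $\langle\cdot,\cdot\rangle$, and let $x\cdot y\in\mathbb C^7$ denote the octonionic-imaginary part of the product of $x,y\in\mathbb C^7$; here the octonion multiplication is given by $e_i^2=-1$, $e_je_i=-e_ie_j$ for $i\ne j$, and $e_1e_2=-e_5$, $e_1e_3=-e_6$, $e_1e_4=-e_7$, $e_1e_5=e_2$, $e_1e_6=e_3$, $e_1e_7=e_4$, $e_2e_3=-e_7$, $e_2e_4=e_6$, $e_2e_5=-e_1$, $e_2e_6=-e_4$, $e_2e_7=e_3$, $e_3e_4=-e_5$, $e_3e_5=e_4$, $e_3e_6=-e_1$, $e_3e_7=-e_2$, $e_4e_5=-e_3$, $e_4e_6=e_2$, $e_4e_7=-e_1$, $e_5e_6=e_7$, $e_5e_7=-e_6$, $e_6e_7=e_5$. A complex coassociative plane is an isotropic $2$-plane $\mathcal C\subset\mathbb C^7$ with $\mathcal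 C\cdot\mathcal C=0$. For an isotropic line $L$ and $\alpha\in\mathbb C\setminus\mathbb R$ let \[ p_{\alpha,L}(\lambda)=\frac{\lambda-\bar\alpha}{\lambda-\alpha}\,\pi_{\overline L}+\pi_{(L\oplus\overline L)^\perp}+\frac{\lambda-\alpha}{\lambda-\bar\alpha}\,\pi_L , \] where the $\pi$'s are the projections of the decomposition $\mathbb C^7=L\oplus(L\oplus\overline L)^\perp\oplus\overline L$. A pair $(L,K)$ of isotropic lines satisfies the $G_2$ pair condition if $K\subset\overline L^{\perp}$ and $L\oplus\pi_{(L\oplus\overline L)^\perp}K$ is a complex coassociative plane; for such a pair put $p_{\alpha,L,K}=p_{\alpha,L}\,p_{\alpha,K}$. For a rational loop $h$ of invertible matrices that is holomorphic at $\alpha$ (that is, it has no pole at $\alpha$ and $h(\alpha)$ is invertible), put \[ p_{\alpha,K}*h=p_{\alpha,K}\,h\,p_{\alpha,h(\alpha)^{-1}K}^{-1}. \] Corollary (Permutability). Let $(L,K)$ and $(M,N)$ be pairs of isotropic lines in $\mathbb C^7$ satisfying the $G_2$ pair condition, and let $\alpha,\beta\in\mathbb C\setminus\mathbb R$ with $\alpha\ne\beta,\bar\beta$.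 Put \begin{align*} K'&=p_{\beta,M,N}(\alpha)K, & L'&=(p_{\alpha,K'}*p_{\beta,M,N})(\alpha)L,\\ N'&=p_{\alpha,L,K}(\beta)N, & M'&=(p_{\beta,N'}*p_{\alpha,L,K})(\beta)M . \end{align*} These lines are well defined: $p_{\beta,M,N}$ and $p_{\alpha,K'}*p_{\beta,M,N}$ are holomorphic at $\alpha$, and $p_{\alpha,L,K}$ and $p_{\beta,N'}*p_{\alpha,L,K}$ are holomorphic at $\beta$, after filling in removable singularities. Moreover $(L',K')$ and $(M',N')$ are again pairs of isotropic lines satisfying the $G_2$ pair condition, and \[ p_{\alpha,L',K'}\,p_{\beta,M,N}=p_{\beta,M',N'}\,p_{\alpha,L,K}. \] -/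

import Mathlib

noncomputable section

namespace G2Loop

/-- The complex space `ℂ⁷ = Im(𝕆) ⊗ ℂ`, with its standard Hermitian inner product. The
coordinates `0, …, 6` are those with respect to the octonionic imaginary units `e₁, …, e₇`. -/
abbrev V : Type := EuclideanSpace ℂ (Fin 7)

/-- The octonionic-imaginary part `x · y` of the product of `x, y ∈ Im(𝕆) ⊗ ℂ`, for the
multiplication table given (up to `eⱼ eᵢ = - eᵢ eⱼ` for `i ≠ j`, and `eᵢ² = -1`) by
`e₁e₂ = -e₅`, `e₁e₃ = -e₆`, `e₁e₄ = -e₇`, `e₁e₅ = e₂`, `e₁e₆ = e₃`, `e₁e₇ = e₄`,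
`e₂e₃ = -e₇`, `e₂e₄ = e₆`, `e₂e₅ = -e₁`, `e₂e₆ = -e₄`, `e₂e₇ = e₃`,
`e₃e₄ = -e₅`, `e₃e₅ = e₄`, `e₃e₆ = -e₁`, `e₃e₇ = -e₂`,
`e₄e₅ = -e₃`, `e₄e₆ = e₂`, `e₄e₇ = -e₁`, `e₅e₆ = e₇`, `e₅e₇ = -e₆`, `e₆e₇ = e₅`. -/
def octProd (x y : V) : V :=
  !₂[-(x 1 * y 4 - x 4 * y 1) - (x 2 * y 5 - x 5 * y 2) - (x 3 * y 6 - x 6 * y 3),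
     (x 0 * y 4 - x 4 * y 0) - (x 2 * y 6 - x 6 * y 2) + (x 3 * y 5 - x 5 * y 3),
     (x 0 * y 5 - x 5 * y 0) + (x 1 * y 6 - x 6 * y 1) - (x 3 * y 4 - x 4 * y 3),
     (x 0 * y 6 - x 6 * y 0) - (x 1 * y 5 - x 5 * y 1) + (x 2 * y 4 - x 4 * y 2),
     -(x 0 * y 1 - x 1 * y 0) - (x 2 * y 3 - x 3 * y 2) + (x 5 * y 6 - x 6 * y 5),
     -(x 0 * y 2 - x 2 * y 0) + (x 1 * y 3 - x 3 * y 1) - (x 4 * y 6 - x 6 * y 4),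
     -(x 0 * y 3 - x 3 * y 0) - (x 1 * y 2 - x 2 * y 1) + (x 4 * y 5 - x 5 * y 4)]

/-- The symmetric complex bilinear form `⟨x, y⟩ = ∑ᵢ xᵢ yᵢ` on `ℂ⁷`. -/
def bil (x y : V) : ℂ := ∑ i, x i * y i

/-- The orthogonal complement `W^⊥` with respect to the complex bilinear form. -/
def perp (W : Submodule ℂ V) : Submodule ℂ V where
  carrier := {x | ∀ w ∈ W, bil x w = 0}
  zero_mem' := by
    intro w _
    simp [bil]
  add_mem' := by
    intro a b ha hb w hw
    have h1 := ha w hw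
    have h2 := hb w hw
    simp only [bil] at h1 h2 ⊢
    simp [add_mul, Finset.sum_add_distrib, h1, h2]
  smul_mem' := by
    intro c a ha w hw
    have h1 := ha w hw
    simp only [bil] at h1 ⊢
    simp [mul_assoc, ← Finset.mul_sum, h1]

/-- Coordinatewise complex conjugation on `ℂ⁷`. -/
def conjMap : V →ₛₗ[starRingEnd ℂ] V where
  toFun x := WithLp.toLp 2 fun i => starRingEnd ℂ (x i)
  map_add' x y := by
    ext i
    simp
  map_smul' c x := by
    ext i
    simp

/-- The conjugate subspace `W̄`. -/
def conjSub (W : Submodule ℂ V) : Submodule ℂ V := W.map conjMap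

/-- `W` is isotropic for the complex bilinear form. -/
def IsIsotropic (W : Submodule ℂ V) : Prop := ∀ x ∈ W, ∀ y ∈ W, bil x y = 0

/-- An isotropic line in `ℂ⁷`. -/
def IsIsotropicLine (L : Submodule ℂ V) : Prop :=
  Module.finrank ℂ L = 1 ∧ IsIsotropic L

/-- A complex coassociative plane: an isotropic `2`-plane `C` with `C · C = 0`. -/
def IsComplexCoassociative (C : Submodule ℂ V) : Prop :=
  Module.finrank ℂ C = 2 ∧ IsIsotropic C ∧ ∀ x ∈ C, ∀ y ∈ C, octProd x y = 0

/-- The matrix of the Hermitian orthogonal projection onto `W`. For an isotropic line `L` the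
decomposition `ℂ⁷ = L ⊕ (L ⊕ L̄)^⊥ ⊕ L̄` is Hermitian orthogonal, so the projections onto
its summands along the other two are the Hermitian orthogonal ones. -/
def projMat (W : Submodule ℂ V) : Matrix (Fin 7) (Fin 7) ℂ :=
  (Matrix.toEuclideanCLM (n := Fin 7) (𝕜 := ℂ)).symm W.starProjection

/-- The image `A W` of a subspace under a matrix. -/
def image (A : Matrix (Fin 7) (Fin 7) ℂ) (W : Submodule ℂ V) : Submodule ℂ V :=
  W.map (Matrix.toEuclideanLin A)

/-- The condition on a pair of lines: `L` and `K` are isotropic lines, `K ⊆ L̄^⊥`, and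
`L ⊕ π_{(L ⊕ L̄)^⊥} K` is complex coassociative (the sum is direct since it has to be a plane). -/
structure IsG2Pair (L K : Submodule ℂ V) : Prop where
  isotropicLine_left : IsIsotropicLine L
  isotropicLine_right : IsIsotropicLine K
  le_perp : K ≤ perp (conjSub L)
  coassociative :
    IsComplexCoassociative (L ⊔ image (projMat (perp (L ⊔ conjSub L))) K)

/-- A rational loop of endomorphisms of `ℂ⁷`: a matrix whose entries are rational functions of the
loop parameter `λ`. -/
abbrev Loop : Type := Matrix (Fin 7) (Fin 7) (RatFunc ℂ)

/-- The value `g(a)` of a rational loop at a point `a`, read off from the reduced fractions, so that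
removable singularities are filled in. -/
def evalAt (g : Loop) (a : ℂ) : Matrix (Fin 7) (Fin 7) ℂ :=
  g.map (RatFunc.eval (RingHom.id ℂ) a)

/-- The loop `g` is holomorphic at `a` as a loop of invertible matrices: no entry has a pole at
`a`, and the value at `a` is invertible. -/
def IsHolomorphicAt (g : Loop) (a : ℂ) : Prop :=
  (∀ i j, (g i j).denom.eval a ≠ 0) ∧ IsUnit (evalAt g a)

/-- The rational function `(λ - a) / (λ - b)`. -/
def mobius (a b : ℂ) : RatFunc ℂ :=
  (RatFunc.X - RatFunc.C a) / (RatFunc.X - RatFunc.C b)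

/-- A constant matrix as a constant loop. -/
def constLoop (A : Matrix (Fin 7) (Fin 7) ℂ) : Loop := A.map RatFunc.C

/-- The loop `p_{α,L}(λ) = ((λ - ᾱ)/(λ - α)) π_{L̄} + π_{(L ⊕ L̄)^⊥} + ((λ - α)/(λ - ᾱ)) π_L`. -/
def simpleLoop (α : ℂ) (L : Submodule ℂ V) : Loop :=
  mobius (starRingEnd ℂ α) α • constLoop (projMat (conjSub L))
    + constLoop (projMat (perp (L ⊔ conjSub L)))
    + mobius α (starRingEnd ℂ α) • constLoop (projMat L)

/-- The product `p_{α,L,K} = p_{α,L} p_{α,K}`. -/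
def pairLoop (α : ℂ) (L K : Submodule ℂ V) : Loop := simpleLoop α L * simpleLoop α K

/-- The dressing-type action `p_{α,K} * h = p_{α,K} h p_{α,K'}⁻¹` with `K' = h(α)⁻¹ K`. -/
def dress (α : ℂ) (K : Submodule ℂ V) (h : Loop) : Loop :=
  simpleLoop α K * h * (simpleLoop α (image (evalAt h α)⁻¹ K))⁻¹

end G2Loop

end

noncomputable section

namespace G2Loop

open Filter Topology Matrix

/-! Write t = (λ - α)/(λ - ᾱ), so that p_{α,L} acts by t⁻¹, 1, t on L̄, (L ⊕ L̄)^⊥, L. Every loop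
involved is complex orthogonal, real, tends to 1 at ∞, and has its poles in a single conjugate pair
(`GoodLoop`).

Permutability. If h is such a loop without pole at α, then p_{α,h(α)L} h p_{α,L}⁻¹ has removable
singularities at α and ᾱ, so it has poles only where h may have them (`GoodLoop.dressed`). Dressing
p_{β,M,N} first with K and then with L gives p_{α,L',K'} p_{β,M,N} = h' p_{α,L,K}, where h' has
poles only in {β, β̄}. Exchanging roles gives p_{β,M',N'} p_{α,L,K} = k' p_{β,M,N}, where k' has
poles only in {α, ᾱ}. Hence p_{β,M',N'} h'⁻¹ = k' p_{α,L',K'}⁻¹ has no poles at all and tends to 1,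
so by Liouville it equals 1 (`eq_of_goodLoop_mul_eq`).

Pair condition. It is read off from the values and the polar part of p_{α,L,K}. For a G₂ pair the
values are automorphisms of the octonionic product, because they factor into transvections along
planes with zero product (`act_scaling_mul_scaling`, `octProd_transvection`). A Liouville argument
applied to the transported product shows that p_{α,L',K'} is again automorphism-valued
(`GoodLoop.preservesOct`). Its pole at α is simple with nonzero residue, since left and right
multiplication by loops invertible at α preserve this. The leading term of the automorphism identity
says that the range of the residue has zero product, and this range contains the conjugate of L' ⊕
πK' (`IsG2Pair.of_mul_eq`, `isG2Pair_of_pairResidue`). -/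

/-! ### Rational functions: poles, values and limits. -/

/-- The rational function `f` has no pole at `a`. -/
def RegularAt (f : RatFunc ℂ) (a : ℂ) : Prop := f.denom.eval a ≠ 0

/-- The value of a rational function at a point, with removable singularities filled in. -/
abbrev value (f : RatFunc ℂ) (a : ℂ) : ℂ := RatFunc.eval (RingHom.id ℂ) a f

lemma value_eq (f : RatFunc ℂ) (a : ℂ) : value f a = f.num.eval a / f.denom.eval a := rfl

lemma RegularAt.of_dvd {f : RatFunc ℂ} {p : Polynomial ℂ} {a : ℂ} (h : f.denom ∣ p)
    (hp : p.eval a ≠ 0) : RegularAt f a := fun h0 =>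
  hp (Polynomial.eval_eq_zero_of_dvd_of_eval_eq_zero h h0)

lemma RegularAt.mul {f g : RatFunc ℂ} {a : ℂ} (hf : RegularAt f a) (hg : RegularAt g a) :
    RegularAt (f * g) a :=
  .of_dvd (RatFunc.denom_mul_dvd f g) (by simpa using ⟨hf, hg⟩)

lemma RegularAt.add {f g : RatFunc ℂ} {a : ℂ} (hf : RegularAt f a) (hg : RegularAt g a) :
    RegularAt (f + g) a :=
  .of_dvd (RatFunc.denom_add_dvd f g) (by simpa using ⟨hf, hg⟩)

lemma value_mul {f g : RatFunc ℂ} {a : ℂ} (hf : RegularAt f a) (hg : RegularAt g a) :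
    value (f * g) a = value f a * value g a := RatFunc.eval_mul _ _ hf hg

lemma value_add {f g : RatFunc ℂ} {a : ℂ} (hf : RegularAt f a) (hg : RegularAt g a) :
    value (f + g) a = value f a + value g a := RatFunc.eval_add _ _ hf hg

lemma regularAt_C (c a : ℂ) : RegularAt (RatFunc.C c) a := by simp [RegularAt]

lemma regularAt_zero (a : ℂ) : RegularAt 0 a := by simp [RegularAt]

lemma regularAt_sum {ι : Type*} (s : Finset ι) (f : ι → RatFunc ℂ) (a : ℂ)
    (h : ∀ i ∈ s, RegularAt (f i) a) :
    RegularAt (∑ i ∈ s, f i) a ∧ value (∑ i ∈ s, f i) a = ∑ i ∈ s, value (f i) a := by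
  classical
  induction s using Finset.induction_on with
  | empty => simp [regularAt_zero]
  | insert i s hi ih =>
    obtain ⟨h1, h2⟩ := ih fun j hj => h j (Finset.mem_insert_of_mem hj)
    have h3 := h i (Finset.mem_insert_self i s)
    rw [Finset.sum_insert hi, Finset.sum_insert hi]
    exact ⟨h3.add h1, by rw [value_add h3 h1, h2]⟩

lemma eventually_regularAt (f : RatFunc ℂ) : ∀ᶠ z in cofinite, RegularAt f z := by
  have : {z | ¬ RegularAt f z} = {z | f.denom.IsRoot z} := by
    ext z
    simp [RegularAt, Polynomial.IsRoot]
  rw [eventually_cofinite, this]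
  exact Polynomial.finite_setOfPred_isRoot f.denom_ne_zero

lemma ratFunc_eq_of_eventually {f g : RatFunc ℂ} (h : ∀ᶠ z in cofinite, value f z = value g z) :
    f = g := by
  have h1 : f.num * g.denom = g.num * f.denom := by
    apply Polynomial.eq_of_infinite_eval_eq
    refine Set.Infinite.mono ?_ (frequently_cofinite_iff_infinite.1
      ((h.and ((eventually_regularAt f).and (eventually_regularAt g))).frequently))
    rintro z ⟨h1, h2, h3⟩
    rw [value_eq, value_eq, div_eq_div_iff h2 h3] at h1
    simpa using h1
  rw [← RatFunc.num_div_denom f, ← RatFunc.num_div_denom g, div_eq_div_iff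
    (RatFunc.algebraMap_ne_zero f.denom_ne_zero) (RatFunc.algebraMap_ne_zero g.denom_ne_zero),
    ← map_mul, ← map_mul, h1]

lemma RegularAt.differentiableAt {f : RatFunc ℂ} {a : ℂ} (hf : RegularAt f a) :
    DifferentiableAt ℂ (value f) a := by
  have : value f = fun z => f.num.eval z / f.denom.eval z := rfl
  rw [this]
  exact f.num.differentiableAt.div f.denom.differentiableAt hf

/-- If the reduced denominator vanished at `a`, a finite limit would force the numerator to vanish
there too, against coprimality. This turns limits into removable singularities. -/
lemma regularAt_of_tendsto {f : RatFunc ℂ} {a c : ℂ} (h : Tendsto (value f) (𝓝[≠] a) (𝓝 c)) :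
    RegularAt f a ∧ value f a = c := by
  have h1 : RegularAt f a := by
    intro h0
    have hd : Tendsto (fun z => f.denom.eval z) (𝓝[≠] a) (𝓝 0) := by
      rw [← h0]
      exact f.denom.continuous.continuousAt.tendsto.mono_left nhdsWithin_le_nhds
    have hn : Tendsto (fun z => f.num.eval z) (𝓝[≠] a) (𝓝 (f.num.eval a)) :=
      f.num.continuous.continuousAt.tendsto.mono_left nhdsWithin_le_nhds
    have hm := h.mul hd
    rw [mul_zero] at hm
    have h2 : f.num.eval a = 0 := by
      refine tendsto_nhds_unique hn (hm.congr' ?_)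
      filter_upwards [nhdsNE_le_cofinite _ (eventually_regularAt f)] with z hz
      rw [value_eq, div_mul_cancel₀ _ hz]
    obtain ⟨u, v, huv⟩ := f.isCoprime_num_denom
    simpa [h0, h2] using congrArg (Polynomial.eval a) huv
  refine ⟨h1, tendsto_nhds_unique ?_ h⟩
  exact h1.differentiableAt.continuousAt.tendsto.mono_left nhdsWithin_le_nhds

/-! ### Matrix-valued rational loops. -/

/-- The loop `g` has no pole at `a`. -/
def LoopRegularAt (g : Loop) (a : ℂ) : Prop := ∀ i j, RegularAt (g i j) a

lemma LoopRegularAt.mul {g h : Loop} {a : ℂ} (hg : LoopRegularAt g a) (hh : LoopRegularAt h a) :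
    LoopRegularAt (g * h) a := fun i j => by
  rw [Matrix.mul_apply]
  exact (regularAt_sum _ _ a fun k _ => (hg i k).mul (hh k j)).1

lemma LoopRegularAt.transpose {g : Loop} {a : ℂ} (hg : LoopRegularAt g a) :
    LoopRegularAt g.transpose a := fun i j => hg j i

lemma evalAt_mul {g h : Loop} {a : ℂ} (hg : LoopRegularAt g a) (hh : LoopRegularAt h a) :
    evalAt (g * h) a = evalAt g a * evalAt h a := by
  ext i j
  refine (regularAt_sum Finset.univ (fun k => g i k * h k j) a
    fun k _ => (hg i k).mul (hh k j)).2.trans ?_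
  exact Finset.sum_congr rfl fun k _ => value_mul (hg i k) (hh k j)

lemma evalAt_transpose (g : Loop) (a : ℂ) : evalAt g.transpose a = (evalAt g a).transpose := rfl

lemma evalAt_one (a : ℂ) : evalAt 1 a = 1 := by
  ext i j
  by_cases h : i = j <;> simp [evalAt, h, Matrix.one_apply]

lemma eventually_loopRegularAt (g : Loop) : ∀ᶠ z in cofinite, LoopRegularAt g z := by
  simp only [LoopRegularAt, eventually_all]
  exact fun i j => eventually_regularAt _

lemma eventually_evalAt_mul (g h : Loop) :
    ∀ᶠ z in cofinite, evalAt (g * h) z = evalAt g z * evalAt h z := by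
  filter_upwards [eventually_loopRegularAt g, eventually_loopRegularAt h] with z h1 h2
  exact evalAt_mul h1 h2

lemma loop_eq_of_eventually {g h : Loop} (H : ∀ᶠ z in cofinite, evalAt g z = evalAt h z) :
    g = h := by
  ext1 i j
  refine ratFunc_eq_of_eventually ?_
  filter_upwards [H] with z hz
  exact congrFun (congrFun hz i) j

lemma LoopRegularAt.continuousAt {g : Loop} {a : ℂ} (hg : LoopRegularAt g a) :
    ContinuousAt (evalAt g) a :=
  tendsto_pi_nhds.2 fun i => tendsto_pi_nhds.2 fun j =>
    (hg i j).differentiableAt.continuousAt.tendsto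

lemma LoopRegularAt.tendsto {g : Loop} {a : ℂ} (hg : LoopRegularAt g a) :
    Tendsto (evalAt g) (𝓝[≠] a) (𝓝 (evalAt g a)) :=
  hg.continuousAt.tendsto.mono_left nhdsWithin_le_nhds

lemma loopRegularAt_of_tendsto {g : Loop} {a : ℂ} {A : Matrix (Fin 7) (Fin 7) ℂ}
    (h : Tendsto (evalAt g) (𝓝[≠] a) (𝓝 A)) : LoopRegularAt g a := fun i j =>
  (regularAt_of_tendsto (tendsto_pi_nhds.1 (tendsto_pi_nhds.1 h i) j)).1

lemma LoopRegularAt.exists_tendsto_slope {g : Loop} {a : ℂ} (hg : LoopRegularAt g a) :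
    ∃ E : Matrix (Fin 7) (Fin 7) ℂ,
      Tendsto (fun z => (z - a)⁻¹ • (evalAt g z - evalAt g a)) (𝓝[≠] a) (𝓝 E) :=
  ⟨fun i j => deriv (value (g i j)) a, tendsto_pi_nhds.2 fun i => tendsto_pi_nhds.2 fun j =>
    hasDerivAt_iff_tendsto_slope.1 (hg i j).differentiableAt.hasDerivAt⟩

lemma regularAt_mobius {a b z : ℂ} (hz : z ≠ b) :
    RegularAt (mobius a b) z ∧ value (mobius a b) z = (z - a) / (z - b) := by
  have h : mobius a b = algebraMap (Polynomial ℂ) (RatFunc ℂ) (Polynomial.X - Polynomial.C a) /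
      algebraMap (Polynomial ℂ) (RatFunc ℂ) (Polynomial.X - Polynomial.C b) := by
    simp [mobius]
  have hb : (Polynomial.X - Polynomial.C b).eval z ≠ 0 := by simpa [sub_eq_zero] using hz
  have hr : RegularAt (mobius a b) z := by
    refine .of_dvd ?_ hb
    rw [h]
    exact RatFunc.denom_div_dvd _ _
  refine ⟨hr, ?_⟩
  have h2 : mobius a b * algebraMap (Polynomial ℂ) (RatFunc ℂ) (Polynomial.X - Polynomial.C b) =
      algebraMap (Polynomial ℂ) (RatFunc ℂ) (Polynomial.X - Polynomial.C a) := by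
    rw [h, div_mul_cancel₀]
    exact RatFunc.algebraMap_ne_zero (Polynomial.X_sub_C_ne_zero b)
  have h3 := congrArg (fun f => value f z) h2
  rw [value_mul hr (by rw [RegularAt, RatFunc.denom_algebraMap]; simp)] at h3
  rw [eq_div_iff (sub_ne_zero.2 hz)]
  simpa [value_eq, RatFunc.num_algebraMap, RatFunc.denom_algebraMap, -map_sub] using h3

lemma regularAt_smul_constLoop {f : RatFunc ℂ} {z : ℂ} (hf : RegularAt f z)
    (A : Matrix (Fin 7) (Fin 7) ℂ) :
    LoopRegularAt (f • constLoop A) z ∧ evalAt (f • constLoop A) z = value f z • A := by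
  refine ⟨fun i j => hf.mul (regularAt_C _ _), ?_⟩
  ext i j
  have := value_mul hf (regularAt_C (A i j) z)
  simpa [evalAt, constLoop] using this

lemma LoopRegularAt.add {g h : Loop} {a : ℂ} (hg : LoopRegularAt g a) (hh : LoopRegularAt h a) :
    LoopRegularAt (g + h) a ∧ evalAt (g + h) a = evalAt g a + evalAt h a := by
  refine ⟨fun i j => (hg i j).add (hh i j), ?_⟩
  ext i j
  exact value_add (hg i j) (hh i j)

lemma loopRegularAt_constLoop (A : Matrix (Fin 7) (Fin 7) ℂ) (z : ℂ) :
    LoopRegularAt (constLoop A) z ∧ evalAt (constLoop A) z = A := by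
  refine ⟨fun i j => regularAt_C _ _, ?_⟩
  ext i j
  simp [evalAt, constLoop]

/-! ### Matrices acting on ℂ⁷. -/

/-- The action of a matrix on `ℂ⁷`. -/
def act (A : Matrix (Fin 7) (Fin 7) ℂ) (x : V) : V :=
  Matrix.toEuclideanCLM (n := Fin 7) (𝕜 := ℂ) A x

lemma act_apply (A : Matrix (Fin 7) (Fin 7) ℂ) (x : V) (i : Fin 7) :
    act A x i = ∑ j, A i j * x j := rfl

lemma act_mul (A B : Matrix (Fin 7) (Fin 7) ℂ) (x : V) : act (A * B) x = act A (act B x) := by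
  simp [act]

lemma act_one (x : V) : act 1 x = x := by simp [act]

lemma act_add (A : Matrix (Fin 7) (Fin 7) ℂ) (x y : V) : act A (x + y) = act A x + act A y := by
  simp [act]

lemma act_smul (A : Matrix (Fin 7) (Fin 7) ℂ) (c : ℂ) (x : V) : act A (c • x) = c • act A x := by
  simp [act]

lemma act_zero (A : Matrix (Fin 7) (Fin 7) ℂ) : act A 0 = 0 := by simp [act]

lemma add_act (A B : Matrix (Fin 7) (Fin 7) ℂ) (x : V) : act (A + B) x = act A x + act B x := by
  simp [act]

lemma smul_act (c : ℂ) (A : Matrix (Fin 7) (Fin 7) ℂ) (x : V) : act (c • A) x = c • act A x := by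
  simp [act]

lemma act_single (A : Matrix (Fin 7) (Fin 7) ℂ) (i j : Fin 7) :
    act A (EuclideanSpace.single j 1) i = A i j := by
  simp [act_apply]

lemma matrix_ext_act {A B : Matrix (Fin 7) (Fin 7) ℂ} (h : ∀ x, act A x = act B x) : A = B := by
  ext i j
  rw [← act_single A, ← act_single B, h]

lemma tendsto_act {ι : Type*} {l : Filter ι} {A : ι → Matrix (Fin 7) (Fin 7) ℂ} {x : ι → V}
    {A₀ : Matrix (Fin 7) (Fin 7) ℂ} {x₀ : V} (hA : Tendsto A l (𝓝 A₀)) (hx : Tendsto x l (𝓝 x₀)) :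
    Tendsto (fun i => act (A i) (x i)) l (𝓝 (act A₀ x₀)) := by
  have h1 : ∀ j, Tendsto (fun i => act (A i) (x i) j) l (𝓝 (act A₀ x₀ j)) := fun j => by
    simp only [act_apply]
    refine tendsto_finsetSum _ fun k _ => Tendsto.mul ?_ ?_
    · exact tendsto_pi_nhds.1 (tendsto_pi_nhds.1 hA j) k
    · exact ((PiLp.continuous_apply 2 _ k).tendsto x₀).comp hx
  exact ((PiLp.continuous_toLp 2 _).tendsto _).comp (tendsto_pi_nhds.2 h1)

@[fun_prop]
lemma _root_.Continuous.act {X : Type*} [TopologicalSpace X] {A : X → Matrix (Fin 7) (Fin 7) ℂ}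
    {x : X → V} (hA : Continuous A) (hx : Continuous x) :
    Continuous fun i => act (A i) (x i) :=
  continuous_iff_continuousAt.2 fun i => tendsto_act (hA.tendsto i) (hx.tendsto i)

lemma tendsto_matrix_of_act {ι : Type*} {l : Filter ι} {A : ι → Matrix (Fin 7) (Fin 7) ℂ}
    {f : V → V} (h : ∀ x, Tendsto (fun i => act (A i) x) l (𝓝 (f x))) :
    ∃ A₀, Tendsto A l (𝓝 A₀) := by
  refine ⟨fun i j => f (EuclideanSpace.single j 1) i, tendsto_pi_nhds.2 fun i =>
    tendsto_pi_nhds.2 fun j => ?_⟩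
  have := ((PiLp.continuous_apply 2 _ i).tendsto _).comp (h (EuclideanSpace.single j 1))
  refine this.congr fun k => ?_
  exact act_single (A k) i j

/-! ### The bilinear form and conjugation -/

lemma bil_comm (x y : V) : bil x y = bil y x := by
  simp [bil, mul_comm]

lemma bil_add_left (x y z : V) : bil (x + y) z = bil x z + bil y z := by
  simp [bil, add_mul, Finset.sum_add_distrib]

lemma bil_add_right (x y z : V) : bil x (y + z) = bil x y + bil x z := by
  simp [bil, mul_add, Finset.sum_add_distrib]

lemma bil_sub_left (x y z : V) : bil (x - y) z = bil x z - bil y z := by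
  simp [bil, sub_mul, Finset.sum_sub_distrib]

lemma bil_sub_right (x y z : V) : bil x (y - z) = bil x y - bil x z := by
  simp [bil, mul_sub, Finset.sum_sub_distrib]

lemma bil_smul_left (c : ℂ) (x y : V) : bil (c • x) y = c * bil x y := by
  simp [bil, Finset.mul_sum, mul_assoc]

lemma bil_smul_right (c : ℂ) (x y : V) : bil x (c • y) = c * bil x y := by
  simp [bil, Finset.mul_sum, mul_left_comm]

lemma bil_zero_right (x : V) : bil x 0 = 0 := by simp [bil]

@[fun_prop]
lemma _root_.Continuous.bil {X : Type*} [TopologicalSpace X] {x y : X → V} (hx : Continuous x)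
    (hy : Continuous y) : Continuous fun i => bil (x i) (y i) := by
  unfold G2Loop.bil
  fun_prop

lemma conjMap_apply (x : V) (i : Fin 7) : conjMap x i = starRingEnd ℂ (x i) := rfl

@[simp] lemma conjMap_conjMap (x : V) : conjMap (conjMap x) = x := by
  ext i
  simp [conjMap_apply]

lemma conjMap_eq_zero {x : V} : conjMap x = 0 ↔ x = 0 :=
  ⟨fun h => by rw [← conjMap_conjMap x, h, map_zero], fun h => by rw [h, map_zero]⟩

lemma bil_conjMap (x y : V) : bil (conjMap x) (conjMap y) = starRingEnd ℂ (bil x y) := by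
  simp [bil, conjMap_apply]

lemma bil_conjMap_left (x y : V) : bil (conjMap x) y = starRingEnd ℂ (bil x (conjMap y)) := by
  rw [← bil_conjMap, conjMap_conjMap]

lemma inner_eq_bil (x y : V) : inner ℂ x y = bil (conjMap x) y := by
  simp [bil, conjMap_apply, PiLp.inner_apply, mul_comm]

lemma bil_conjMap_self (x : V) : bil (conjMap x) x = ((‖x‖ ^ 2 : ℝ) : ℂ) := by
  rw [← inner_eq_bil, inner_self_eq_norm_sq_to_K]
  simp

lemma bil_conjMap_self_ne_zero {x : V} (hx : x ≠ 0) : bil (conjMap x) x ≠ 0 := by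
  rw [bil_conjMap_self]
  exact_mod_cast pow_ne_zero 2 (norm_ne_zero_iff.2 hx)

lemma bil_self_conjMap_ne_zero {x : V} (hx : x ≠ 0) : bil x (conjMap x) ≠ 0 := by
  rw [bil_comm]
  exact bil_conjMap_self_ne_zero hx

lemma bil_act (A : Matrix (Fin 7) (Fin 7) ℂ) (x y : V) :
    bil (act A x) y = bil x (act A.transpose y) := by
  simp only [bil, act_apply, Finset.sum_mul, Finset.mul_sum, Matrix.transpose_apply]
  rw [Finset.sum_comm]
  exact Finset.sum_congr rfl fun i _ => Finset.sum_congr rfl fun j _ => by ring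

lemma bil_act_act {A : Matrix (Fin 7) (Fin 7) ℂ} (hA : A.transpose * A = 1) (x y : V) :
    bil (act A x) (act A y) = bil x y := by
  rw [bil_act, ← act_mul, hA, act_one]

lemma conjMap_act (A : Matrix (Fin 7) (Fin 7) ℂ) (x : V) :
    conjMap (act A x) = act (A.map (starRingEnd ℂ)) (conjMap x) := by
  ext i
  simp [conjMap_apply, act_apply]

lemma ext_bil {x y : V} (h : ∀ z, bil x z = bil y z) : x = y := by
  by_contra hne
  refine bil_self_conjMap_ne_zero (sub_ne_zero.2 hne) ?_
  rw [bil_sub_left, h, sub_self]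

/-! ### Lines and their projections -/

lemma conjSub_span (v : V) : conjSub (ℂ ∙ v) = ℂ ∙ conjMap v := by
  simp [conjSub, Submodule.map_span]

lemma image_span (A : Matrix (Fin 7) (Fin 7) ℂ) (v : V) : image A (ℂ ∙ v) = ℂ ∙ act A v := by
  simp only [image, Submodule.map_span, Set.image_singleton]
  rfl

lemma isIsotropicLine_span {v : V} (hv : v ≠ 0) (h : bil v v = 0) : IsIsotropicLine (ℂ ∙ v) := by
  refine ⟨finrank_span_singleton hv, ?_⟩
  intro x hx y hy
  obtain ⟨a, rfl⟩ := Submodule.mem_span_singleton.1 hx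
  obtain ⟨b, rfl⟩ := Submodule.mem_span_singleton.1 hy
  simp [bil_smul_left, bil_smul_right, h]

lemma IsIsotropicLine.exists_span {L : Submodule ℂ V} (h : IsIsotropicLine L) :
    ∃ v : V, L = ℂ ∙ v ∧ v ≠ 0 ∧ bil v v = 0 := by
  obtain ⟨v, hv, hspan⟩ := finrank_eq_one_iff'.1 h.1
  have hL : L = ℂ ∙ (v : V) := by
    apply le_antisymm
    · intro x hx
      obtain ⟨c, hc⟩ := hspan ⟨x, hx⟩
      exact Submodule.mem_span_singleton.2 ⟨c, congrArg Subtype.val hc⟩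
    · exact (Submodule.span_singleton_le_iff_mem _ _).2 v.2
  exact ⟨v, hL, by simpa using hv, h.2 v v.2 v v.2⟩

lemma act_projMat (W : Submodule ℂ V) (x : V) : act (projMat W) x = W.starProjection x := by
  simp [act, projMat]

lemma act_projMat_span (v x : V) :
    act (projMat (ℂ ∙ v)) x = (bil (conjMap v) x / bil (conjMap v) v) • v := by
  rw [act_projMat, Submodule.starProjection_singleton, inner_eq_bil, bil_conjMap_self]
  simp

lemma act_projMat_conjSub_span (v x : V) :
    act (projMat (conjSub (ℂ ∙ v))) x = (bil v x / bil (conjMap v) v) • conjMap v := by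
  rw [conjSub_span, act_projMat_span, conjMap_conjMap, bil_comm v (conjMap v)]

lemma mem_perp_span_sup {v x : V} : x ∈ perp (ℂ ∙ v ⊔ conjSub (ℂ ∙ v)) ↔
    bil v x = 0 ∧ bil (conjMap v) x = 0 := by
  rw [conjSub_span]
  constructor
  · intro h
    constructor
    · rw [bil_comm]
      exact h _ (Submodule.mem_sup_left (Submodule.mem_span_singleton_self _))
    · rw [bil_comm]
      exact h _ (Submodule.mem_sup_right (Submodule.mem_span_singleton_self _))
  · rintro ⟨h1, h2⟩ y hy
    obtain ⟨a, ha, b, hb, rfl⟩ := Submodule.mem_sup.1 hy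
    obtain ⟨a, rfl⟩ := Submodule.mem_span_singleton.1 ha
    obtain ⟨b, rfl⟩ := Submodule.mem_span_singleton.1 hb
    rw [bil_comm]
    simp [bil_add_left, bil_smul_left, h1, h2]

lemma act_projMat_perp {v : V} (hv : v ≠ 0) (h : bil v v = 0) (x : V) :
    act (projMat (perp (ℂ ∙ v ⊔ conjSub (ℂ ∙ v)))) x =
      x - (bil v x / bil (conjMap v) v) • conjMap v
        - (bil (conjMap v) x / bil (conjMap v) v) • v := by
  have hn := bil_conjMap_self_ne_zero hv
  have h' : bil (conjMap v) (conjMap v) = 0 := by rw [bil_conjMap, h, map_zero]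
  rw [act_projMat]
  apply Submodule.eq_starProjection_of_mem_orthogonal
  · rw [mem_perp_span_sup]
    simp [bil_sub_right, bil_smul_right, h, h', bil_comm v (conjMap v), hn]
  · rw [Submodule.mem_orthogonal]
    intro u hu
    obtain ⟨h1, h2⟩ := mem_perp_span_sup.1 hu
    have h3 : bil (conjMap u) v = 0 := by
      rw [bil_conjMap_left, bil_comm, h2, map_zero]
    have h4 : bil (conjMap u) (conjMap v) = 0 := by
      rw [bil_conjMap, bil_comm, h1, map_zero]
    rw [inner_eq_bil]
    simp [bil_sub_right, bil_smul_right, h3, h4]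

/-- The matrix acting by `t` on `L`, by `t⁻¹` on `L̄` and trivially on `(L ⊕ L̄)^⊥`. -/
def scaling (t : ℂ) (L : Submodule ℂ V) : Matrix (Fin 7) (Fin 7) ℂ :=
  t⁻¹ • projMat (conjSub L) + projMat (perp (L ⊔ conjSub L)) + t • projMat L

lemma act_scaling {v : V} (hv : v ≠ 0) (h : bil v v = 0) (t : ℂ) (x : V) :
    act (scaling t (ℂ ∙ v)) x = x + ((t⁻¹ - 1) * (bil v x / bil (conjMap v) v)) • conjMap v
      + ((t - 1) * (bil (conjMap v) x / bil (conjMap v) v)) • v := by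
  have : act (scaling t (ℂ ∙ v)) x = t⁻¹ • act (projMat (conjSub (ℂ ∙ v))) x +
      act (projMat (perp (ℂ ∙ v ⊔ conjSub (ℂ ∙ v)))) x + t • act (projMat (ℂ ∙ v)) x := by
    simp only [scaling, add_act, smul_act]
  rw [this, act_projMat_span, act_projMat_conjSub_span, act_projMat_perp hv h]
  module

/-- Exchanging L and L̄ exchanges the eigenvalues t and t⁻¹. This reduces the behaviour at ᾱ to that
at α. -/
lemma scaling_span_conjMap {v : V} (hv : v ≠ 0) (h : bil v v = 0) (t : ℂ) :
    scaling t (ℂ ∙ conjMap v) = scaling t⁻¹ (ℂ ∙ v) := by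
  refine matrix_ext_act fun x => ?_
  rw [act_scaling hv h, act_scaling (conjMap_eq_zero.not.2 hv)
    (by rw [bil_conjMap, h, map_zero]), conjMap_conjMap, bil_comm v (conjMap v), inv_inv]
  module

/-- The isotropic lines L and L̄ are dual under the bilinear form, so transposing swaps their
eigenvalues. Together with the next lemma this makes scalings orthogonal. -/
lemma transpose_scaling {v : V} (hv : v ≠ 0) (h : bil v v = 0) (t : ℂ) :
    (scaling t (ℂ ∙ v)).transpose = scaling t⁻¹ (ℂ ∙ v) := by
  refine matrix_ext_act fun x => ext_bil fun y => ?_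
  rw [bil_act, Matrix.transpose_transpose, act_scaling hv h, act_scaling hv h]
  simp only [bil_add_left, bil_add_right, bil_smul_left, bil_smul_right, inv_inv]
  rw [bil_comm x v, bil_comm x (conjMap v)]
  ring

lemma scaling_mul_scaling_inv {v : V} (hv : v ≠ 0) (h : bil v v = 0) {t : ℂ} (ht : t ≠ 0) :
    scaling t (ℂ ∙ v) * scaling t⁻¹ (ℂ ∙ v) = 1 := by
  have hn := bil_conjMap_self_ne_zero hv
  have h' : bil (conjMap v) (conjMap v) = 0 := by rw [bil_conjMap, h, map_zero]
  refine matrix_ext_act fun x => ?_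
  rw [act_mul, act_one, act_scaling hv h, act_scaling hv h]
  simp only [bil_add_right, bil_smul_right, inv_inv, h, h', bil_comm v (conjMap v)]
  match_scalars <;> field_simp <;> ring

lemma map_conj_scaling {v : V} (hv : v ≠ 0) (h : bil v v = 0) (t : ℂ) :
    (scaling t (ℂ ∙ v)).map (starRingEnd ℂ) = scaling (starRingEnd ℂ t)⁻¹ (ℂ ∙ v) := by
  refine matrix_ext_act fun x => ?_
  rw [← conjMap_conjMap x, ← conjMap_act, act_scaling hv h, act_scaling hv h]
  have hr : starRingEnd ℂ (bil (conjMap v) v) = bil (conjMap v) v := by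
    rw [← bil_conjMap, conjMap_conjMap, bil_comm]
  simp only [map_add, map_smulₛₗ, map_mul, map_div₀, map_sub, map_inv₀, hr, conjMap_conjMap,
    map_one, inv_inv, ← bil_conjMap]
  module

/-! ### The octonionic product and its automorphisms. -/

lemma octProd_add_left (x y z : V) : octProd (x + y) z = octProd x z + octProd y z := by
  ext i
  fin_cases i <;> simp [octProd] <;> ring

lemma octProd_add_right (x y z : V) : octProd x (y + z) = octProd x y + octProd x z := by
  ext i
  fin_cases i <;> simp [octProd] <;> ring

lemma octProd_smul_left (c : ℂ) (x y : V) : octProd (c • x) y = c • octProd x y := by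
  ext i
  fin_cases i <;> simp [octProd] <;> ring

lemma octProd_smul_right (c : ℂ) (x y : V) : octProd x (c • y) = c • octProd x y := by
  ext i
  fin_cases i <;> simp [octProd] <;> ring

lemma octProd_self (x : V) : octProd x x = 0 := by
  ext i
  fin_cases i <;> simp [octProd] <;> ring

lemma octProd_anticomm (x y : V) : octProd x y = -octProd y x := by
  ext i
  fin_cases i <;> simp [octProd] <;> ring

lemma octProd_conjMap (x y : V) : octProd (conjMap x) (conjMap y) = conjMap (octProd x y) := by
  ext i
  fin_cases i <;> simp [octProd, conjMap_apply]

lemma octProd_eq_zero_of_conjMap {x y : V} (h : octProd (conjMap x) (conjMap y) = 0) :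
    octProd x y = 0 := by
  rwa [octProd_conjMap, conjMap_eq_zero] at h

/-- The component of `u ∧ v` in the Lie algebra of `G₂`, as an endomorphism of `ℂ⁷`. -/
def wedgeDer (u v x : V) : V :=
  (3 : ℂ) • (bil v x • u - bil u x • v) + octProd (octProd u v) x

-- A polynomial identity checked in coordinates. Its use is that the correction term drops out when
-- u · v = 0, so that the infinitesimal rotation u ∧ v is then itself a derivation.
set_option maxHeartbeats 1000000 in
lemma wedgeDer_octProd (u v x y : V) :
    wedgeDer u v (octProd x y) = octProd (wedgeDer u v x) y + octProd x (wedgeDer u v y) := by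
  ext i
  fin_cases i <;> simp [octProd, wedgeDer, bil, Fin.sum_univ_seven] <;> ring

/-- The matrix `A` preserves the product of imaginary octonions. -/
def PreservesOct (A : Matrix (Fin 7) (Fin 7) ℂ) : Prop :=
  ∀ x y, octProd (act A x) (act A y) = act A (octProd x y)

/-- The map `x ↦ x + s (⟨v, x⟩ u - ⟨u, x⟩ v)`. -/
def transvection (u v : V) (s : ℂ) (x : V) : V := x + s • (bil v x • u - bil u x • v)

/-- The map is 1 + sD with D = u ∧ v. The terms linear in s match because D is a derivation, and the
term s² Dx · Dy vanishes because D takes values in the span of u and v, where the product is zero.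
-/
lemma octProd_transvection {u v : V} (h : octProd u v = 0) (s : ℂ) (x y : V) :
    octProd (transvection u v s x) (transvection u v s y) =
      transvection u v s (octProd x y) := by
  have hder := wedgeDer_octProd u v x y
  have h0 : ∀ z, octProd 0 z = 0 := fun z => by
    simpa using octProd_smul_left 0 0 z
  have hz : ∀ z, wedgeDer u v z = (3 : ℂ) • (bil v z • u - bil u z • v) := fun z => by
    rw [wedgeDer, h, h0, add_zero]
  simp only [hz, octProd_smul_left, octProd_smul_right, ← smul_add] at hder
  have hder := smul_right_injective V (three_ne_zero (α := ℂ)) hder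
  have hvu : octProd v u = 0 := by rw [octProd_anticomm, h, neg_zero]
  have hsq : octProd (bil v x • u - bil u x • v) (bil v y • u - bil u y • v) = 0 := by
    simp [sub_eq_add_neg, ← neg_smul, octProd_add_left, octProd_add_right, octProd_smul_left,
      octProd_smul_right, octProd_self, h, hvu]
  simp only [transvection, octProd_add_left, octProd_add_right, octProd_smul_left,
    octProd_smul_right, hsq, hder]
  module

set_option maxHeartbeats 1000000 in
/-- For a `G₂` pair the product of scalings acts on the plane `L̄ ⊕ W` through `SL₂`; it is written
as a product of four transvections in that group. -/
lemma act_scaling_mul_scaling {l w : V} {a t : ℂ} (hl : bil l l = 0) (hw : bil w w = 0)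
    (hlw : bil l w = 0) (hlw' : bil (conjMap l) w = 0) (hl1 : bil (conjMap l) l = 1)
    (hw1 : bil (conjMap w) w = 1) (ht : t ≠ 0) (hta : t + a * starRingEnd ℂ a ≠ 0) :
    ∃ c₁ c₂ c₃ c₄ : ℂ, ∀ x,
      act (scaling t (ℂ ∙ l) * scaling t (ℂ ∙ (a • conjMap l + w))) x =
        transvection (conjMap l) (conjMap w) c₁ (transvection w l c₂
          (transvection (conjMap l) (conjMap w) c₃ (transvection w l c₄ x))) := by
  have hl0 : l ≠ 0 := by
    rintro rfl
    simp [bil_zero_right] at hl1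
  have hcc : ∀ {x y : V}, bil x y = 0 → bil (conjMap x) (conjMap y) = 0 := fun h => by
    rw [bil_conjMap, h, map_zero]
  have e1 := hcc hl
  have e2 := hcc hw
  have e3 := hcc hlw
  have e4 : bil l (conjMap w) = 0 := by
    have := hcc hlw'
    rwa [conjMap_conjMap] at this
  have e5 : bil w l = 0 := by rw [bil_comm, hlw]
  have e6 : bil w (conjMap l) = 0 := by rw [bil_comm, hlw']
  have e7 : bil (conjMap w) l = 0 := by rw [bil_comm, e4]
  have e8 : bil (conjMap w) (conjMap l) = 0 := by rw [bil_comm, e3]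
  have e9 : bil l (conjMap l) = 1 := by rw [bil_comm, hl1]
  have e10 : bil w (conjMap w) = 1 := by rw [bil_comm, hw1]
  set k := a • conjMap l + w with hk
  have hk0 : k ≠ 0 := by
    intro h0
    have : bil (conjMap w) k = 1 := by simp [hk, bil_add_right, bil_smul_right, e8, hw1]
    rw [h0, bil_zero_right] at this
    exact zero_ne_one this
  have hkk : bil k k = 0 := by
    simp [hk, bil_add_right, bil_add_left, bil_smul_right, bil_smul_left, hw, e1, e6, hlw']
  have hck : conjMap k = starRingEnd ℂ a • l + conjMap w := by simp [hk]
  generalize starRingEnd ℂ a = b at hta hck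
  have hn : bil (conjMap k) k = a * b + 1 := by
    rw [hck, hk]
    simp [bil_add_right, bil_add_left, bil_smul_right, bil_smul_left, hlw, e8, e9, hw1]
  have hn0 : a * b + 1 ≠ 0 := hn ▸ bil_conjMap_self_ne_zero hk0
  -- In the basis (l̄, w) the transvections along (l̄, w̄) and (w, l) are the upper and lower
  -- unipotent matrices. Fixing c₂ = 1, the bottom row of the 2 × 2 matrix determines c₃ and c₄, and
  -- the top row then gives c₁. The division is by t + ab, a multiple of the lower right entry.
  -- Three factors would not do: for a = 0 the matrix is diag(t⁻¹, t).
  refine ⟨((1 + (t - 1) * (a * b) / (a * b + 1)) / t) - ((t - 1) * a / ((a * b + 1) * t)) *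
      (((t - 1) * b - (a * b + 1)) / (t + a * b)) - 1, 1, (t - 1) / (a * b + 1),
      (((t - 1) * b - (a * b + 1)) / (t + a * b)), fun x => ?_⟩
  rw [act_mul, act_scaling hk0 hkk, act_scaling hl0 hl, hn, hl1, hck, hk]
  simp only [transvection, bil_add_right, bil_add_left, bil_sub_right, bil_smul_right,
    bil_smul_left, hl, hw, hlw, hlw', hl1, hw1, e1, e2, e3, e4, e5, e6, e7, e8, e9, e10]
  generalize bil l x = X1
  generalize bil w x = X2
  generalize bil (conjMap l) x = X3
  generalize bil (conjMap w) x = X4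
  have hn0' : b * a + 1 ≠ 0 := mul_comm a b ▸ hn0
  have hta' : t + b * a ≠ 0 := mul_comm a b ▸ hta
  match_scalars <;> field_simp <;> ring

lemma preservesOct_scaling_mul_scaling {l w : V} {a t : ℂ} (hl : bil l l = 0) (hw : bil w w = 0)
    (hlw : bil l w = 0) (hlw' : bil (conjMap l) w = 0) (hl1 : bil (conjMap l) l = 1)
    (hw1 : bil (conjMap w) w = 1) (ho : octProd l w = 0)
    (ht : t ≠ 0) (hta : t + a * starRingEnd ℂ a ≠ 0) :
    PreservesOct (scaling t (ℂ ∙ l) * scaling t (ℂ ∙ (a • conjMap l + w))) := by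
  obtain ⟨c₁, c₂, c₃, c₄, hc⟩ := act_scaling_mul_scaling hl hw hlw hlw' hl1 hw1 ht hta
  have h1 : octProd w l = 0 := by rw [octProd_anticomm, ho, neg_zero]
  have h2 : octProd (conjMap l) (conjMap w) = 0 := by rw [octProd_conjMap, ho, map_zero]
  intro x y
  rw [hc, hc, hc, octProd_transvection h2, octProd_transvection h1, octProd_transvection h2,
    octProd_transvection h1]

/-! ### Generators of a G₂ pair. -/

lemma span_smul_eq {c : ℂ} (hc : c ≠ 0) (v : V) : (ℂ ∙ (c • v)) = ℂ ∙ v :=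
  Submodule.span_singleton_smul_eq (IsUnit.mk0 c hc) v

lemma exists_smul_unit {v : V} (hv : v ≠ 0) :
    ∃ c : ℂ, c ≠ 0 ∧ bil (conjMap (c • v)) (c • v) = 1 := by
  refine ⟨(‖v‖ : ℂ)⁻¹, by simpa using hv, ?_⟩
  rw [bil_conjMap_self, norm_smul]
  simp [hv]

/-- Since K ⊆ L̄^⊥, a generator of K has no L-component, so it is its projection w to (L ⊕ L̄)^⊥
plus a multiple of l̄. Here w ≠ 0 because the coassociative space has dimension 2, and both l and w
can be normalised. -/
lemma IsG2Pair.exists_span {L K : Submodule ℂ V} (h : IsG2Pair L K) :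
    ∃ (l w : V) (a : ℂ), L = ℂ ∙ l ∧ K = ℂ ∙ (a • conjMap l + w) ∧ bil l l = 0 ∧ bil w w = 0 ∧
      bil l w = 0 ∧ bil (conjMap l) w = 0 ∧ bil (conjMap l) l = 1 ∧ bil (conjMap w) w = 1 ∧
      octProd l w = 0 := by
  obtain ⟨l₀, rfl, hl₀, hll₀⟩ := h.isotropicLine_left.exists_span
  obtain ⟨k, rfl, hk, hkk⟩ := h.isotropicLine_right.exists_span
  obtain ⟨c, hc, hl1⟩ := exists_smul_unit hl₀
  rw [← span_smul_eq hc l₀] at h ⊢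
  have hll : bil (c • l₀) (c • l₀) = 0 := by simp [bil_smul_left, bil_smul_right, hll₀]
  have hl : c • l₀ ≠ 0 := smul_ne_zero hc hl₀
  generalize c • l₀ = l at h hl1 hll hl
  have hlk : bil (conjMap l) k = 0 := by
    rw [bil_comm]
    exact h.le_perp (Submodule.mem_span_singleton_self k) _
      (by rw [conjSub_span]; exact Submodule.mem_span_singleton_self _)
  have hco := h.coassociative
  rw [image_span, act_projMat_perp hl hll, hlk, hl1] at hco
  set w := k - bil l k • conjMap l with hw
  have e1 : bil (conjMap l) (conjMap l) = 0 := by rw [bil_conjMap, hll, map_zero]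
  have e2 : bil l (conjMap l) = 1 := by rw [bil_comm, hl1]
  have e3 : bil k (conjMap l) = 0 := by rw [bil_comm, hlk]
  simp only [div_one, zero_smul, sub_zero, ← hw] at hco
  have hlw : bil l w = 0 := by simp [hw, bil_sub_right, bil_smul_right, e2]
  have hlw' : bil (conjMap l) w = 0 := by simp [hw, bil_sub_right, bil_smul_right, hlk, e1]
  have hww : bil w w = 0 := by
    simp [hw, bil_sub_right, bil_sub_left, bil_smul_left, bil_smul_right, hlk, e1, hkk, e3]
  have hw0 : w ≠ 0 := by
    intro h0
    have h1 := hco.1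
    rw [h0, Submodule.span_zero_singleton, sup_bot_eq, finrank_span_singleton hl] at h1
    norm_num at h1
  have ho : octProd l w = 0 := hco.2.2 l (Submodule.mem_sup_left
    (Submodule.mem_span_singleton_self l)) w (Submodule.mem_sup_right
    (Submodule.mem_span_singleton_self w))
  obtain ⟨d, hd, hd1⟩ := exists_smul_unit hw0
  refine ⟨l, d • w, d * bil l k, rfl, ?_, hll, ?_, ?_, ?_, hl1, hd1, ?_⟩
  · rw [mul_smul, ← smul_add, span_smul_eq hd, hw, add_sub_cancel]
  · simp [bil_smul_left, bil_smul_right, hww]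
  · simp [bil_smul_right, hlw]
  · simp [bil_smul_right, hlw']
  · rw [octProd_smul_right, ho, smul_zero]

lemma isG2Pair_span {l k : V} (hl : l ≠ 0) (hk : k ≠ 0) (hll : bil l l = 0) (hkk : bil k k = 0)
    (hlk : bil (conjMap l) k = 0)
    (hw : k - (bil l k / bil (conjMap l) l) • conjMap l ≠ 0)
    (ho : octProd l (k - (bil l k / bil (conjMap l) l) • conjMap l) = 0) :
    IsG2Pair (ℂ ∙ l) (ℂ ∙ k) := by
  refine ⟨isIsotropicLine_span hl hll, isIsotropicLine_span hk hkk, ?_, ?_⟩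
  · rw [Submodule.span_singleton_le_iff_mem, conjSub_span]
    intro y hy
    obtain ⟨c, rfl⟩ := Submodule.mem_span_singleton.1 hy
    rw [bil_comm, bil_smul_left, hlk, mul_zero]
  · rw [image_span, act_projMat_perp hl hll, hlk, zero_div, zero_smul, sub_zero]
    have hn := bil_conjMap_self_ne_zero hl
    have e1 : bil (conjMap l) (conjMap l) = 0 := by rw [bil_conjMap, hll, map_zero]
    have e3 : bil k (conjMap l) = 0 := by rw [bil_comm, hlk]
    set w := k - (bil l k / bil (conjMap l) l) • conjMap l with hw'
    have hlw : bil l w = 0 := by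
      rw [hw', bil_sub_right, bil_smul_right, bil_comm l (conjMap l), div_mul_cancel₀ _ hn,
        sub_self]
    have hlw' : bil (conjMap l) w = 0 := by simp [hw', bil_sub_right, bil_smul_right, hlk, e1]
    have hww : bil w w = 0 := by
      simp [hw', bil_sub_right, bil_sub_left, bil_smul_left, bil_smul_right, hlk, e1, hkk, e3]
    have hmem : ∀ x ∈ (ℂ ∙ l) ⊔ (ℂ ∙ w), ∃ a b : ℂ, x = a • l + b • w := by
      intro x hx
      obtain ⟨y, hy, z, hz, rfl⟩ := Submodule.mem_sup.1 hx
      obtain ⟨a, rfl⟩ := Submodule.mem_span_singleton.1 hy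
      obtain ⟨b, rfl⟩ := Submodule.mem_span_singleton.1 hz
      exact ⟨a, b, rfl⟩
    refine ⟨?_, ?_, ?_⟩
    · have hdisj : (ℂ ∙ l) ⊓ (ℂ ∙ w) = ⊥ := by
        rw [eq_bot_iff]
        rintro x ⟨hx, hx'⟩
        obtain ⟨a, rfl⟩ := Submodule.mem_span_singleton.1 hx
        obtain ⟨b, hb⟩ := Submodule.mem_span_singleton.1 hx'
        have := congrArg (bil (conjMap l)) hb
        rw [bil_smul_right, bil_smul_right, hlw', mul_zero] at this
        have ha : a = 0 := by simpa [hn] using this.symm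
        simp [ha]
      have := Submodule.finrank_sup_add_finrank_inf_eq (ℂ ∙ l) (ℂ ∙ w)
      rw [hdisj, finrank_bot, finrank_span_singleton hl, finrank_span_singleton hw] at this
      exact this
    · intro x hx y hy
      obtain ⟨a, b, rfl⟩ := hmem x hx
      obtain ⟨c, d, rfl⟩ := hmem y hy
      simp [bil_add_left, bil_add_right, bil_smul_left, bil_smul_right, hll, hww, hlw,
        bil_comm w l]
    · intro x hx y hy
      obtain ⟨a, b, rfl⟩ := hmem x hx
      obtain ⟨c, d, rfl⟩ := hmem y hy
      have ho' : octProd w l = 0 := by rw [octProd_anticomm, ho, neg_zero]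
      simp [octProd_add_left, octProd_add_right, octProd_smul_left, octProd_smul_right,
        octProd_self, ho, ho']

/-! ### Cancellation of poles under dressing. -/

/-- The expansion, without negative powers of `t`, of an orthogonal matrix `A = H + t E` multiplied by
scalings of the lines spanned by `v` and `H v`. -/
def dressExpansion (v : V) (H : Matrix (Fin 7) (Fin 7) ℂ) (x : V) (t : ℂ)
    (A E : Matrix (Fin 7) (Fin 7) ℂ) : V :=
  let ν := bil (conjMap v) v
  let ν' := bil (conjMap (act H v)) (act H v)
  let b := x + ((t - 1) * (bil v x / ν)) • conjMap v - (bil (conjMap v) x / ν) • v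
  let u := act A b + (bil (conjMap v) x / ν) • act E v
  let m := bil v x + bil (act H v) (act E b) -
    bil (conjMap v) x / ν / 2 * bil (act E v) (act E v)
  u + (bil (conjMap v) x / ν) • act H v
    + ((t - 1) * (bil (conjMap (act H v)) u / ν')) • act H v
    + ((1 - t) * (m / ν')) • conjMap (act H v)

/-- Conjugating an orthogonal matrix `H + t E` by scalings of the lines spanned by `v` and `H v`
produces no negative powers of `t`. -/
lemma act_scaling_mul_mul_scaling {v : V} (hv : v ≠ 0) (hvv : bil v v = 0) {t : ℂ} (ht : t ≠ 0)
    {A H E : Matrix (Fin 7) (Fin 7) ℂ} (hA : A = H + t • E) (hAo : A.transpose * A = 1)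
    (hHo : H.transpose * H = 1) (x : V) :
    act (scaling t (ℂ ∙ act H v) * A * scaling t⁻¹ (ℂ ∙ v)) x =
      dressExpansion v H x t A E := by
  unfold dressExpansion
  extract_lets ν ν' b u m
  have hν : ν ≠ 0 := bil_conjMap_self_ne_zero hv
  have hHv : act H v ≠ 0 := by
    intro h0
    apply hv
    rw [← act_one v, ← hHo, act_mul, h0, act_zero]
  have hHvv : bil (act H v) (act H v) = 0 := by rw [bil_act_act hHo, hvv]
  have hν' : ν' ≠ 0 := bil_conjMap_self_ne_zero hHv
  have hAv : act A v = act H v + t • act E v := by rw [hA, add_act, smul_act]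
  have hm1 : bil (act H v) (act E v) = -(t / 2) * bil (act E v) (act E v) := by
    have h1 : bil (act A v) (act A v) = 0 := by rw [bil_act_act hAo, hvv]
    rw [hAv] at h1
    simp only [bil_add_left, bil_add_right, bil_smul_left, bil_smul_right, hHvv,
      bil_comm (act E v) (act H v)] at h1
    apply mul_left_cancel₀ ht
    linear_combination h1 / 2
  -- The last scaling multiplies the component of u along the conjugate of Hv by t⁻¹. Orthogonality
  -- of A and H makes this component divisible by t.
  have hm : bil (act H v) u = t * m := by
    have h1 : bil v b = t * bil v x := by
      simp only [b, bil_sub_right, bil_add_right, bil_smul_right, hvv, bil_comm v (conjMap v)]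
      change bil v x + (t - 1) * (bil v x / ν) * ν - _ = _
      field_simp
      ring
    simp only [u, m, hA, add_act, smul_act, bil_add_right, bil_smul_right, hm1,
      bil_act_act hHo, h1]
    ring
  have hy : act (scaling t⁻¹ (ℂ ∙ v)) x = b + (t⁻¹ * (bil (conjMap v) x / ν)) • v := by
    rw [act_scaling hv hvv, inv_inv]
    simp only [b, ν]
    module
  have hz : act A (act (scaling t⁻¹ (ℂ ∙ v)) x) =
      u + (t⁻¹ * (bil (conjMap v) x / ν)) • act H v := by
    rw [hy, act_add, act_smul, hAv]
    simp only [u]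
    match_scalars <;> field_simp
  rw [act_mul, act_mul, hz, act_scaling hHv hHvv]
  simp only [bil_add_right, bil_smul_right, hHvv, hm]
  change _ + ((t⁻¹ - 1) * ((t * m + _) / ν')) • _ + ((t - 1) * ((_ + _ * ν') / ν')) • _ = _
  match_scalars <;> field_simp <;> ring

lemma tendsto_mobius (a b : ℂ) (hab : a ≠ b) :
    Tendsto (fun z : ℂ => (z - a) / (z - b)) (𝓝[≠] a) (𝓝 0) := by
  have : ContinuousAt (fun z : ℂ => (z - a) / (z - b)) a := by
    refine ContinuousAt.div (by fun_prop) (by fun_prop) (sub_ne_zero.2 hab)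
  simpa using this.tendsto.mono_left nhdsWithin_le_nhds

lemma eventually_ne_nhdsNE (a b : ℂ) : ∀ᶠ z in 𝓝[≠] a, z ≠ b :=
  Filter.Eventually.filter_mono (nhdsNE_le_cofinite a) (by simp [eventually_cofinite])

/-- Near α, t is a local coordinate and h = h(α) + tE with E convergent, so the limit is the value
of the pole-free expansion at t = 0. -/
lemma exists_tendsto_scaling_mul_mul_scaling {α : ℂ} (hα : α ≠ starRingEnd ℂ α) {v : V}
    (hv : v ≠ 0) (hvv : bil v v = 0) {h : Loop} (hreg : LoopRegularAt h α)
    (ho : ∀ᶠ z in 𝓝 α, (evalAt h z).transpose * evalAt h z = 1) :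
    ∃ A, Tendsto (fun z => scaling ((z - α) / (z - starRingEnd ℂ α)) (ℂ ∙ act (evalAt h α) v) *
      evalAt h z * scaling ((z - α) / (z - starRingEnd ℂ α))⁻¹ (ℂ ∙ v)) (𝓝[≠] α) (𝓝 A) := by
  obtain ⟨E₀, hE₀⟩ := hreg.exists_tendsto_slope
  have hsub : Tendsto (fun z : ℂ => z - starRingEnd ℂ α) (𝓝[≠] α) (𝓝 (α - starRingEnd ℂ α)) :=
    ((continuous_id.sub continuous_const).tendsto α).mono_left nhdsWithin_le_nhds
  -- The factor z - ᾱ turns the difference quotient in z - α into one in t.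
  have hE := hsub.smul hE₀
  have ht := tendsto_mobius α _ hα
  set H := evalAt h α with hH
  let F : V → ℂ × Matrix (Fin 7) (Fin 7) ℂ × Matrix (Fin 7) (Fin 7) ℂ → V := fun x p =>
    dressExpansion v H x p.1 p.2.1 p.2.2
  have hF : ∀ x, Continuous (F x) := fun x => by
    simp only [F, dressExpansion, div_eq_mul_inv]
    fun_prop
  have hlim := ht.prodMk_nhds (hreg.tendsto.prodMk_nhds hE)
  refine tendsto_matrix_of_act (f := fun x => F x (0, H, (α - starRingEnd ℂ α) • E₀)) fun x => ?_
  refine (((hF x).tendsto _).comp hlim).congr' ?_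
  filter_upwards [ho.filter_mono nhdsWithin_le_nhds, self_mem_nhdsWithin,
    eventually_ne_nhdsNE α (starRingEnd ℂ α)] with z hz1 hz2 hz3
  have e1 : z - α ≠ 0 := sub_ne_zero.2 hz2
  have e2 : z - starRingEnd ℂ α ≠ 0 := sub_ne_zero.2 hz3
  refine (act_scaling_mul_mul_scaling hv hvv (div_ne_zero e1 e2) ?_ hz1 ho.self_of_nhds x).symm
  rw [smul_smul, smul_smul, div_mul_cancel₀ _ e2, mul_inv_cancel₀ e1, one_smul]
  simp [hH]

/-! ### The class of good loops and its stability under dressing. -/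

/-- Orthogonal rational loops that satisfy the reality condition, are normalized at `∞` and have
their poles in `{β, β̄}`. -/
structure GoodLoop (β : ℂ) (h : Loop) : Prop where
  orth : h.transpose * h = 1
  real : ∀ᶠ z in cofinite, evalAt h (starRingEnd ℂ z) = (evalAt h z).map (starRingEnd ℂ)
  regular : ∀ z, z ≠ β → z ≠ starRingEnd ℂ β → LoopRegularAt h z
  tendsto_one : Tendsto (evalAt h) (cocompact ℂ) (𝓝 1)

lemma tendsto_conj_cofinite : Tendsto (starRingEnd ℂ) cofinite cofinite :=
  (star_injective (R := ℂ)).tendsto_cofinite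

lemma eventually_cofinite_ne (b : ℂ) : ∀ᶠ z in cofinite, z ≠ b := by
  simp [eventually_cofinite]

lemma evalAt_simpleLoop {α z : ℂ} (h1 : z ≠ α) (h2 : z ≠ starRingEnd ℂ α)
    (L : Submodule ℂ V) : LoopRegularAt (simpleLoop α L) z ∧
      evalAt (simpleLoop α L) z = scaling ((z - α) / (z - starRingEnd ℂ α)) L := by
  obtain ⟨a1, a2⟩ := regularAt_mobius (a := starRingEnd ℂ α) h1
  obtain ⟨b1, b2⟩ := regularAt_mobius (a := α) h2
  obtain ⟨c1, c2⟩ := regularAt_smul_constLoop a1 (projMat (conjSub L))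
  obtain ⟨d1, d2⟩ := regularAt_smul_constLoop b1 (projMat L)
  obtain ⟨e1, e2⟩ := loopRegularAt_constLoop (projMat (perp (L ⊔ conjSub L))) z
  obtain ⟨f1, f2⟩ := c1.add e1
  obtain ⟨g1, g2⟩ := f1.add d1
  refine ⟨g1, ?_⟩
  rw [simpleLoop, g2, f2, c2, d2, e2, a2, b2, scaling, inv_div]

lemma eventually_evalAt_simpleLoop (α : ℂ) (L : Submodule ℂ V) : ∀ᶠ z in cofinite,
    evalAt (simpleLoop α L) z = scaling ((z - α) / (z - starRingEnd ℂ α)) L := by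
  filter_upwards [eventually_cofinite_ne α, eventually_cofinite_ne (starRingEnd ℂ α)] with z h1 h2
  exact (evalAt_simpleLoop h1 h2 L).2

lemma tendsto_mobius_cocompact (a b : ℂ) :
    Tendsto (fun z : ℂ => (z - a) / (z - b)) (cocompact ℂ) (𝓝 1) := by
  have h1 : Tendsto (fun z : ℂ => z - b) (cocompact ℂ) (cocompact ℂ) :=
    (Homeomorph.subRight b).isClosedEmbedding.tendsto_cocompact
  have h2 : Tendsto (fun z : ℂ => 1 + (b - a) * (z - b)⁻¹) (cocompact ℂ) (𝓝 1) := by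
    rw [← Metric.cobounded_eq_cocompact] at h1 ⊢
    have := ((tendsto_inv₀_cobounded (α := ℂ)).comp h1).const_mul (b - a)
    simpa using this.const_add 1
  refine h2.congr' ?_
  filter_upwards [cocompact_le_cofinite (eventually_cofinite_ne b)] with z hz
  have : z - b ≠ 0 := sub_ne_zero.2 hz
  field_simp
  ring

lemma scaling_one {v : V} (hv : v ≠ 0) (hvv : bil v v = 0) : scaling 1 (ℂ ∙ v) = 1 :=
  matrix_ext_act fun x => by simp [act_scaling hv hvv, act_one]

lemma tendsto_scaling {ι : Type*} {l : Filter ι} {t : ι → ℂ} {t₀ : ℂ} (h0 : t₀ ≠ 0)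
    (ht : Tendsto t l (𝓝 t₀)) (L : Submodule ℂ V) :
    Tendsto (fun i => scaling (t i) L) l (𝓝 (scaling t₀ L)) :=
  (((ht.inv₀ h0).smul_const _).add tendsto_const_nhds).add (ht.smul_const _)

lemma goodLoop_simpleLoop (α : ℂ) {L : Submodule ℂ V} (hL : IsIsotropicLine L) :
    GoodLoop α (simpleLoop α L) := by
  obtain ⟨v, rfl, hv, hvv⟩ := hL.exists_span
  have hev := eventually_evalAt_simpleLoop α (ℂ ∙ v)
  refine ⟨?_, ?_, fun z h1 h2 => (evalAt_simpleLoop h1 h2 _).1, ?_⟩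
  · apply loop_eq_of_eventually
    filter_upwards [eventually_evalAt_mul (simpleLoop α (ℂ ∙ v)).transpose (simpleLoop α (ℂ ∙ v)),
      hev, eventually_cofinite_ne α, eventually_cofinite_ne (starRingEnd ℂ α)] with z h1 h2 h3 h4
    have h0 : (z - α) / (z - starRingEnd ℂ α) ≠ 0 :=
      div_ne_zero (sub_ne_zero.2 h3) (sub_ne_zero.2 h4)
    rw [h1, evalAt_transpose, h2, transpose_scaling hv hvv, evalAt_one, mul_eq_one_comm,
      scaling_mul_scaling_inv hv hvv h0]
  · filter_upwards [hev, tendsto_conj_cofinite.eventually hev] with z h1 h2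
    rw [h1, h2, map_conj_scaling hv hvv]
    simp
  · rw [← scaling_one hv hvv]
    refine (tendsto_scaling one_ne_zero (tendsto_mobius_cocompact α (starRingEnd ℂ α)) _).congr' ?_
    filter_upwards [cocompact_le_cofinite hev] with z hz using hz.symm

lemma GoodLoop.mul {β : ℂ} {g h : Loop} (hg : GoodLoop β g) (hh : GoodLoop β h) :
    GoodLoop β (g * h) := by
  have hev := eventually_evalAt_mul g h
  refine ⟨?_, ?_, fun z h1 h2 => (hg.regular z h1 h2).mul (hh.regular z h1 h2), ?_⟩
  · rw [Matrix.transpose_mul, Matrix.mul_assoc, ← Matrix.mul_assoc g.transpose, hg.orth,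
      Matrix.one_mul, hh.orth]
  · filter_upwards [hev, tendsto_conj_cofinite.eventually hev, hg.real, hh.real] with z h1 h2 h3 h4
    rw [h1, h2, h3, h4, Matrix.map_mul]
  · have := hg.tendsto_one.mul hh.tendsto_one
    rw [mul_one] at this
    refine this.congr' ?_
    filter_upwards [cocompact_le_cofinite hev] with z hz using hz.symm

lemma GoodLoop.mul_transpose_self {β : ℂ} {h : Loop} (hh : GoodLoop β h) : h * h.transpose = 1 :=
  mul_eq_one_comm.1 hh.orth

lemma GoodLoop.transpose {β : ℂ} {h : Loop} (hh : GoodLoop β h) : GoodLoop β h.transpose := by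
  refine ⟨hh.mul_transpose_self, ?_, fun z h1 h2 => (hh.regular z h1 h2).transpose, ?_⟩
  · filter_upwards [hh.real] with z hz
    rw [evalAt_transpose, evalAt_transpose, hz]
    rfl
  · have h1 : Tendsto (fun A : Matrix (Fin 7) (Fin 7) ℂ => A.transpose) (𝓝 1) (𝓝 1) := by
      simpa using (continuous_id.matrix_transpose (n := Fin 7) (m := Fin 7) (R := ℂ)).tendsto 1
    exact h1.comp hh.tendsto_one

lemma goodLoop_pairLoop (α : ℂ) {L K : Submodule ℂ V} (hL : IsIsotropicLine L)
    (hK : IsIsotropicLine K) : GoodLoop α (pairLoop α L K) :=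
  (goodLoop_simpleLoop α hL).mul (goodLoop_simpleLoop α hK)

lemma evalAt_transpose_mul {h : Loop} (ho : h.transpose * h = 1) {z : ℂ}
    (hz : LoopRegularAt h z) : (evalAt h z).transpose * evalAt h z = 1 := by
  rw [← evalAt_transpose, ← evalAt_mul hz.transpose hz, ho, evalAt_one]

lemma GoodLoop.isHolomorphicAt {β : ℂ} {h : Loop} (hh : GoodLoop β h) {z : ℂ} (h1 : z ≠ β)
    (h2 : z ≠ starRingEnd ℂ β) : IsHolomorphicAt h z :=
  have h := evalAt_transpose_mul hh.orth (hh.regular z h1 h2)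
  ⟨hh.regular z h1 h2, ⟨⟨evalAt _ z, _, mul_eq_one_comm.1 h, h⟩, rfl⟩⟩

lemma ne_conj_of_ne {z β : ℂ} (h : z ≠ starRingEnd ℂ β) : starRingEnd ℂ z ≠ β := fun h' =>
  h (by rw [← h', Complex.conj_conj])

lemma ne_conj_conj_of_ne {z β : ℂ} (h : z ≠ β) : starRingEnd ℂ z ≠ starRingEnd ℂ β := fun h' =>
  h ((starRingEnd ℂ).injective h')

/-- Reality is only required off a finite set; continuity extends it to every point outside {β, β̄}.
-/
lemma GoodLoop.evalAt_conj {β : ℂ} {h : Loop} (hh : GoodLoop β h) {z : ℂ} (h1 : z ≠ β)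
    (h2 : z ≠ starRingEnd ℂ β) :
    evalAt h (starRingEnd ℂ z) = (evalAt h z).map (starRingEnd ℂ) := by
  have hc1 : ContinuousAt (fun w => evalAt h (starRingEnd ℂ w)) z :=
    ContinuousAt.comp (f := starRingEnd ℂ) (g := evalAt h)
      (hh.regular _ (ne_conj_of_ne h2) (ne_conj_conj_of_ne h1)).continuousAt
      Complex.continuous_conj.continuousAt
  have hc2 : ContinuousAt (fun w => (evalAt h w).map (starRingEnd ℂ)) z := by
    have : Continuous fun A : Matrix (Fin 7) (Fin 7) ℂ => A.map (starRingEnd ℂ) :=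
      continuous_id.matrix_map Complex.continuous_conj
    exact this.continuousAt.comp (hh.regular z h1 h2).continuousAt
  refine tendsto_nhds_unique (hc1.tendsto.mono_left (nhdsWithin_le_nhds (s := {z}ᶜ))) ?_
  refine (hc2.tendsto.mono_left nhdsWithin_le_nhds).congr' ?_
  filter_upwards [nhdsNE_le_cofinite z hh.real] with w hw using hw.symm

lemma GoodLoop.eventually_orth {β : ℂ} {h : Loop} (hh : GoodLoop β h) {z : ℂ} (h1 : z ≠ β)
    (h2 : z ≠ starRingEnd ℂ β) :
    ∀ᶠ w in 𝓝 z, (evalAt h w).transpose * evalAt h w = 1 := by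
  filter_upwards [isOpen_ne.mem_nhds h1, isOpen_ne.mem_nhds h2] with w hw1 hw2
  exact evalAt_transpose_mul hh.orth (hh.regular w hw1 hw2)

/-- The loop `p_{α,h(α)L} h p_{α,L}⁻¹` has poles only where `h` has. -/
lemma GoodLoop.dressed {α β : ℂ} (hα : α.im ≠ 0) (hαβ : α ≠ β) (hαβ' : α ≠ starRingEnd ℂ β)
    {h : Loop} (hh : GoodLoop β h) {L : Submodule ℂ V} (hL : IsIsotropicLine L) :
    IsIsotropicLine (image (evalAt h α) L) ∧
    GoodLoop β (simpleLoop α (image (evalAt h α) L) * h * (simpleLoop α L).transpose) := by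
  obtain ⟨v, rfl, hv, hvv⟩ := hL.exists_span
  have hor := evalAt_transpose_mul hh.orth (hh.regular α hαβ hαβ')
  have hv' : act (evalAt h α) v ≠ 0 := by
    intro h0
    apply hv
    rw [← act_one v, ← hor, act_mul, h0, act_zero]
  have hvv' : bil (act (evalAt h α) v) (act (evalAt h α) v) = 0 := by rw [bil_act_act hor, hvv]
  rw [image_span]
  have hL' := isIsotropicLine_span hv' hvv'
  refine ⟨hL', ?_⟩
  set v' := act (evalAt h α) v with hv'_def
  have hαα : α ≠ starRingEnd ℂ α := fun h' => hα (Complex.conj_eq_iff_im.1 h'.symm)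
  have hp := goodLoop_simpleLoop α hL
  have hp' := goodLoop_simpleLoop α hL'
  have hev : ∀ᶠ z in cofinite,
      evalAt (simpleLoop α (ℂ ∙ v') * h * (simpleLoop α (ℂ ∙ v)).transpose) z =
        scaling ((z - α) / (z - starRingEnd ℂ α)) (ℂ ∙ v') * evalAt h z *
          scaling ((z - α) / (z - starRingEnd ℂ α))⁻¹ (ℂ ∙ v) := by
    filter_upwards [eventually_evalAt_mul (simpleLoop α (ℂ ∙ v') * h) (simpleLoop α (ℂ ∙ v)).transpose,
      eventually_evalAt_mul (simpleLoop α (ℂ ∙ v')) h, eventually_evalAt_simpleLoop α (ℂ ∙ v),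
      eventually_evalAt_simpleLoop α (ℂ ∙ v')] with z h1 h2 h3 h4
    rw [h1, h2, evalAt_transpose, h3, h4, transpose_scaling hv hvv]
  refine ⟨?_, ?_, ?_, ?_⟩
  · simp only [Matrix.transpose_mul, Matrix.transpose_transpose]
    calc _ = simpleLoop α (ℂ ∙ v) * (h.transpose * ((simpleLoop α (ℂ ∙ v')).transpose *
          simpleLoop α (ℂ ∙ v')) * h) * (simpleLoop α (ℂ ∙ v)).transpose := by
          simp only [Matrix.mul_assoc]
      _ = 1 := by rw [hp'.orth, Matrix.mul_one, hh.orth, Matrix.mul_one, hp.mul_transpose_self]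
  · have e1 := eventually_evalAt_mul (simpleLoop α (ℂ ∙ v') * h) (simpleLoop α (ℂ ∙ v)).transpose
    have e2 := eventually_evalAt_mul (simpleLoop α (ℂ ∙ v')) h
    filter_upwards [e1, e2, tendsto_conj_cofinite.eventually e1,
      tendsto_conj_cofinite.eventually e2, hp.transpose.real, hp'.real, hh.real]
      with z h1 h2 h3 h4 h5 h6 h7
    rw [h1, h2, h3, h4, h5, h6, h7, Matrix.map_mul, Matrix.map_mul]
  · intro z hz1 hz2
    by_cases hzα : z = α
    · subst hzα
      obtain ⟨A, hA⟩ := exists_tendsto_scaling_mul_mul_scaling hαα hv hvv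
        (hh.regular z hz1 hz2) (hh.eventually_orth hz1 hz2)
      refine loopRegularAt_of_tendsto (hA.congr' ?_)
      filter_upwards [nhdsNE_le_cofinite z hev] with w hw using hw.symm
    by_cases hzα' : z = starRingEnd ℂ α
    · subst hzα'
      -- By reality the line conjugate to h(α)L is h(ᾱ)L̄, so the singularity at ᾱ is the one
      -- already treated, for the conjugate data.
      have hc : conjMap v' = act (evalAt h (starRingEnd ℂ α)) (conjMap v) := by
        rw [hv'_def, conjMap_act, hh.evalAt_conj hαβ hαβ']
      obtain ⟨A, hA⟩ := exists_tendsto_scaling_mul_mul_scaling (by simpa using hαα.symm)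
        (conjMap_eq_zero.not.2 hv) (by rw [bil_conjMap, hvv, map_zero])
        (hh.regular _ hz1 hz2) (hh.eventually_orth hz1 hz2)
      rw [← hc] at hA
      refine loopRegularAt_of_tendsto (hA.congr' ?_)
      filter_upwards [nhdsNE_le_cofinite _ hev] with w hw
      rw [hw, scaling_span_conjMap hv hvv, scaling_span_conjMap hv' hvv', Complex.conj_conj,
        inv_inv, inv_div, inv_div]
    · exact ((hp'.regular z hzα hzα').mul (hh.regular z hz1 hz2)).mul
        (hp.regular z hzα hzα').transpose
  · have := (hp'.tendsto_one.mul hh.tendsto_one).mul hp.transpose.tendsto_one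
    rw [mul_one, mul_one] at this
    refine this.congr' ?_
    filter_upwards [cocompact_le_cofinite (eventually_evalAt_mul (simpleLoop α (ℂ ∙ v') * h)
      (simpleLoop α (ℂ ∙ v)).transpose), cocompact_le_cofinite
      (eventually_evalAt_mul (simpleLoop α (ℂ ∙ v')) h)] with z h1 h2
    rw [h1, h2]

/-! ### The polar part of p_{α,L,K} and the pair condition. -/

/-- The residue at `α` of `p_{α,L,K}`, up to a constant, if `K ⊆ L̄^⊥`. -/
def pairResidue (L K : Submodule ℂ V) : Matrix (Fin 7) (Fin 7) ℂ :=
  projMat (perp (L ⊔ conjSub L)) * projMat (conjSub K) +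
    projMat (conjSub L) * projMat (perp (K ⊔ conjSub K))

lemma eventually_evalAt_pairLoop (α : ℂ) (L K : Submodule ℂ V) : ∀ᶠ z in cofinite,
    evalAt (pairLoop α L K) z = scaling ((z - α) / (z - starRingEnd ℂ α)) L *
      scaling ((z - α) / (z - starRingEnd ℂ α)) K := by
  filter_upwards [eventually_evalAt_mul (simpleLoop α L) (simpleLoop α K),
    eventually_evalAt_simpleLoop α L, eventually_evalAt_simpleLoop α K] with z h1 h2 h3
  rw [pairLoop, h1, h2, h3]

lemma smul_scaling {t : ℂ} (ht : t ≠ 0) (L : Submodule ℂ V) :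
    t • scaling t L = projMat (conjSub L) +
      t • (projMat (perp (L ⊔ conjSub L)) + t • projMat L) := by
  rw [scaling, smul_add, smul_add, smul_smul, mul_inv_cancel₀ ht, one_smul, smul_add, add_assoc]

lemma tendsto_sq_smul_pairLoop {α : ℂ} (hα : α ≠ starRingEnd ℂ α) (L K : Submodule ℂ V) :
    Tendsto (fun z => ((z - α) / (z - starRingEnd ℂ α)) ^ 2 • evalAt (pairLoop α L K) z)
      (𝓝[≠] α) (𝓝 (projMat (conjSub L) * projMat (conjSub K))) := by
  have ht := tendsto_mobius α _ hα
  have hc : Continuous fun t : ℂ => (projMat (conjSub L) +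
      t • (projMat (perp (L ⊔ conjSub L)) + t • projMat L)) * (projMat (conjSub K) +
      t • (projMat (perp (K ⊔ conjSub K)) + t • projMat K)) := by fun_prop
  have := (hc.tendsto 0).comp ht
  simp only [zero_smul, add_zero] at this
  refine this.congr' ?_
  filter_upwards [nhdsNE_le_cofinite α (eventually_evalAt_pairLoop α L K), self_mem_nhdsWithin,
    eventually_ne_nhdsNE α (starRingEnd ℂ α)] with z h1 h2 h3
  have h0 : (z - α) / (z - starRingEnd ℂ α) ≠ 0 :=
    div_ne_zero (sub_ne_zero.2 h2) (sub_ne_zero.2 h3)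
  rw [Function.comp_apply, h1, ← smul_scaling h0, ← smul_scaling h0, smul_mul_smul_comm, sq]

lemma tendsto_smul_pairLoop {α : ℂ} (hα : α ≠ starRingEnd ℂ α) {L K : Submodule ℂ V}
    (hLK : projMat (conjSub L) * projMat (conjSub K) = 0) :
    Tendsto (fun z => ((z - α) / (z - starRingEnd ℂ α)) • evalAt (pairLoop α L K) z)
      (𝓝[≠] α) (𝓝 (pairResidue L K)) := by
  have ht := tendsto_mobius α _ hα
  have hc : Continuous fun t : ℂ =>
      (projMat (perp (L ⊔ conjSub L)) + t • projMat L) * projMat (conjSub K) +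
      projMat (conjSub L) * (projMat (perp (K ⊔ conjSub K)) + t • projMat K) +
      t • ((projMat (perp (L ⊔ conjSub L)) + t • projMat L) *
        (projMat (perp (K ⊔ conjSub K)) + t • projMat K)) := by fun_prop
  have := (hc.tendsto 0).comp ht
  simp only [zero_smul, add_zero] at this
  refine this.congr' ?_
  filter_upwards [nhdsNE_le_cofinite α (eventually_evalAt_pairLoop α L K), self_mem_nhdsWithin,
    eventually_ne_nhdsNE α (starRingEnd ℂ α)] with z h1 h2 h3
  have h0 : (z - α) / (z - starRingEnd ℂ α) ≠ 0 :=
    div_ne_zero (sub_ne_zero.2 h2) (sub_ne_zero.2 h3)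
  rw [Function.comp_apply, h1]
  generalize (z - α) / (z - starRingEnd ℂ α) = t at h0
  apply smul_right_injective _ h0
  change t • _ = t • (t • _)
  rw [smul_smul, ← smul_mul_smul_comm, smul_scaling h0, smul_scaling h0]
  generalize projMat (perp (L ⊔ conjSub L)) + t • projMat L = B
  generalize projMat (perp (K ⊔ conjSub K)) + t • projMat K = C
  rw [add_mul, mul_add, hLK, mul_add, zero_add]
  simp only [smul_add, mul_smul_comm, smul_mul_assoc]
  abel

/-- The product of projections is the coefficient of t⁻² in p_{α,L,K}, so K ⊆ L̄^⊥ says precisely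
that there is no double pole at α. -/
lemma projMat_mul_projMat_eq_zero_iff {l k : V} (hl : l ≠ 0) (hk : k ≠ 0) :
    projMat (conjSub (ℂ ∙ l)) * projMat (conjSub (ℂ ∙ k)) = 0 ↔ bil (conjMap l) k = 0 := by
  have hν := bil_conjMap_self_ne_zero hl
  have hκ := bil_conjMap_self_ne_zero hk
  have hc : bil (conjMap l) k = 0 ↔ bil l (conjMap k) = 0 := by
    rw [bil_conjMap_left, map_eq_zero]
  rw [hc]
  constructor
  · intro h
    have h1 : act (projMat (conjSub (ℂ ∙ l)) * projMat (conjSub (ℂ ∙ k))) (conjMap k) = 0 := by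
      rw [h]
      simp [act]
    rw [act_mul, act_projMat_conjSub_span k, bil_comm k, div_self hκ, one_smul,
      act_projMat_conjSub_span] at h1
    simpa [hν, conjMap_eq_zero, hl] using h1
  · intro h
    refine matrix_ext_act fun x => ?_
    rw [act_mul, act_projMat_conjSub_span, act_projMat_conjSub_span, bil_smul_right, h]
    simp [act]

/-- With the next lemma, this places the conjugate of L ⊕ πK in the range of the residue, where πK
is the projection of K to (L ⊕ L̄)^⊥. -/
lemma act_pairResidue_conjMap_right {l k : V} (hl : l ≠ 0) (hk : k ≠ 0) (hll : bil l l = 0)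
    (hkk : bil k k = 0) (hlk : bil (conjMap l) k = 0) :
    act (pairResidue (ℂ ∙ l) (ℂ ∙ k)) (conjMap k) =
      conjMap (k - (bil l k / bil (conjMap l) l) • conjMap l) := by
  have hκ := bil_conjMap_self_ne_zero hk
  have hr : starRingEnd ℂ (bil (conjMap l) l) = bil (conjMap l) l := by
    rw [← bil_conjMap, conjMap_conjMap, bil_comm]
  have h1 : bil l (conjMap k) = 0 := by
    rw [bil_comm, bil_conjMap_left, bil_comm, hlk, map_zero]
  have h2 : bil (conjMap k) (conjMap k) = 0 := by rw [bil_conjMap, hkk, map_zero]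
  rw [pairResidue, add_act, act_mul, act_mul, act_projMat_conjSub_span k, bil_comm k, div_self hκ,
    one_smul, act_projMat_perp hl hll, act_projMat_perp hk hkk, bil_comm k, div_self hκ, h1, h2,
    one_smul, zero_div, zero_smul, zero_div, zero_smul, sub_self, sub_zero, sub_zero,
    act_zero, add_zero, map_sub, map_smulₛₗ, map_div₀, hr, conjMap_conjMap, bil_conjMap]

lemma act_pairResidue_conjMap_left {l k : V} (hl : l ≠ 0) (hk : k ≠ 0)
    (hkk : bil k k = 0) (hlk : bil (conjMap l) k = 0)
    (hw : k - (bil l k / bil (conjMap l) l) • conjMap l ≠ 0) :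
    ∃ c : ℂ, c ≠ 0 ∧ act (pairResidue (ℂ ∙ l) (ℂ ∙ k)) (conjMap l) = c • conjMap l := by
  have hν := bil_conjMap_self_ne_zero hl
  have hκ := bil_conjMap_self_ne_zero hk
  have hr : starRingEnd ℂ (bil (conjMap l) l) = bil (conjMap l) l := by
    rw [← bil_conjMap, conjMap_conjMap, bil_comm]
  have h1 : bil k (conjMap l) = 0 := by rw [bil_comm, hlk]
  have h2 : bil (conjMap k) l = 0 := by rw [bil_conjMap_left, h1, map_zero]
  have hww := bil_conjMap_self_ne_zero hw
  -- This constant is ‖w‖²/‖k‖², where w is the projection of k; hence it is nonzero.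
  refine ⟨1 - bil (conjMap k) (conjMap l) / bil (conjMap k) k *
    (bil l k / bil (conjMap l) l), ?_, ?_⟩
  · rw [map_sub, map_smulₛₗ, map_div₀, hr, conjMap_conjMap] at hww
    simp only [bil_sub_left, bil_sub_right, bil_smul_left, bil_smul_right,
      bil_comm l (conjMap l)] at hww
    rw [← bil_conjMap, bil_comm (conjMap l) (conjMap k)] at hww
    intro h0
    apply hww
    field_simp at h0 ⊢
    linear_combination h0
  · rw [pairResidue, add_act, act_mul, act_mul, act_projMat_conjSub_span k, h1, zero_div, zero_smul,
      act_zero, zero_add, act_projMat_perp hk hkk, act_projMat_conjSub_span, h1, zero_div, zero_smul,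
      sub_zero, bil_sub_right, bil_smul_right, bil_comm l (conjMap l), sub_div, div_self hν,
      mul_div_assoc]

/-- The degenerate case K = L̄, where p_{α,L} and p_{α,K} are mutually inverse. A nonzero residue
excludes it, and so guarantees that πK ≠ 0. -/
lemma pairResidue_conj {l : V} (hl : l ≠ 0) (hll : bil l l = 0) :
    pairResidue (ℂ ∙ l) (ℂ ∙ conjMap l) = 0 := by
  have hν := bil_conjMap_self_ne_zero hl
  have hll' : bil (conjMap l) (conjMap l) = 0 := by rw [bil_conjMap, hll, map_zero]
  refine matrix_ext_act fun x => ?_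
  rw [pairResidue, add_act, act_mul, act_mul, act_projMat_conjSub_span (conjMap l),
    act_projMat_perp hl hll, act_projMat_perp (conjMap_eq_zero.not.2 hl) hll',
    act_projMat_conjSub_span, conjMap_conjMap]
  simp [bil_sub_right, bil_smul_right, bil_comm l (conjMap l), hll, hν, act]

lemma IsG2Pair.pairResidue_ne_zero {L K : Submodule ℂ V} (h : IsG2Pair L K) :
    projMat (conjSub L) * projMat (conjSub K) = 0 ∧ pairResidue L K ≠ 0 := by
  obtain ⟨l, w, a, rfl, rfl, hll, hww, hlw, hlw', hl1, hw1, -⟩ := h.exists_span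
  have hl : l ≠ 0 := by
    rintro rfl
    simp [bil_zero_right] at hl1
  have hll' : bil (conjMap l) (conjMap l) = 0 := by rw [bil_conjMap, hll, map_zero]
  have hwl' : bil w (conjMap l) = 0 := by rw [bil_comm, hlw']
  have hw0 : w ≠ 0 := by
    rintro rfl
    simp [bil_zero_right] at hw1
  have hk : a • conjMap l + w ≠ 0 := by
    intro h0
    have := congrArg (bil (conjMap w)) h0
    simp [bil_add_right, bil_smul_right, bil_zero_right, hw1, bil_conjMap, bil_comm w l, hlw]
      at this
  have hlk : bil (conjMap l) (a • conjMap l + w) = 0 := by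
    simp [bil_add_right, bil_smul_right, hll', hlw']
  refine ⟨(projMat_mul_projMat_eq_zero_iff hl hk).2 hlk, fun h0 => ?_⟩
  have hkk : bil (a • conjMap l + w) (a • conjMap l + w) = 0 := by
    simp [bil_add_right, bil_add_left, bil_smul_right, bil_smul_left, hll', hlw', hww, hwl']
  have := act_pairResidue_conjMap_right hl hk hll hkk hlk
  rw [h0, eq_comm, bil_add_right, bil_smul_right, bil_comm l (conjMap l), hl1, hlw] at this
  simp [act, conjMap_eq_zero, hw0] at this

lemma isG2Pair_of_pairResidue {L K : Submodule ℂ V} (hL : IsIsotropicLine L)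
    (hK : IsIsotropicLine K) (h0 : projMat (conjSub L) * projMat (conjSub K) = 0)
    (hR : pairResidue L K ≠ 0)
    (ho : ∀ x y, octProd (act (pairResidue L K) x) (act (pairResidue L K) y) = 0) :
    IsG2Pair L K := by
  obtain ⟨l, rfl, hl, hll⟩ := hL.exists_span
  obtain ⟨k, rfl, hk, hkk⟩ := hK.exists_span
  have hlk := (projMat_mul_projMat_eq_zero_iff hl hk).1 h0
  have hw : k - (bil l k / bil (conjMap l) l) • conjMap l ≠ 0 := by
    intro hw
    rw [sub_eq_zero] at hw
    apply hR
    have hc : bil l k / bil (conjMap l) l ≠ 0 := by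
      intro h
      rw [h, zero_smul] at hw
      exact hk hw
    rw [hw, span_smul_eq hc, pairResidue_conj hl hll]
  refine isG2Pair_span hl hk hll hkk hlk hw ?_
  obtain ⟨c, hc, hcl⟩ := act_pairResidue_conjMap_left hl hk hkk hlk hw
  have := ho (conjMap l) (conjMap k)
  rw [hcl, act_pairResidue_conjMap_right hl hk hll hkk hlk, octProd_smul_left] at this
  exact octProd_eq_zero_of_conjMap ((smul_eq_zero.1 this).resolve_left hc)

/-! ### Liouville arguments and automorphism-valued loops. -/

/-- Two functions, differentiable off disjoint finite sets, which agree almost everywhere and have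
a limit at `∞`, are constant. -/
lemma eq_of_tendsto_cocompact_of_glue {E : Type*} [NormedAddCommGroup E] [NormedSpace ℂ E]
    {f g : ℂ → E} {S T : Set ℂ} {c : E} (hS : S.Finite) (hST : Disjoint S T)
    (hf : ∀ z ∉ S, DifferentiableAt ℂ f z) (hg : ∀ z ∉ T, DifferentiableAt ℂ g z)
    (hfg : ∀ᶠ z in cofinite, f z = g z) (hlim : Tendsto f (cocompact ℂ) (𝓝 c)) :
    ∀ z ∉ S, f z = c := by
  classical
  let F : ℂ → E := fun z => if z ∈ S then g z else f z
  have hFf : ∀ z ∉ S, F z = f z := fun z hz => if_neg hz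
  have hFg : ∀ z ∈ S, F z = g z := fun z hz => if_pos hz
  have hF : Differentiable ℂ F := by
    intro z
    by_cases hz : z ∈ S
    · refine (hg z (Set.disjoint_left.1 hST hz)).congr_of_eventuallyEq ?_
      have h1 : ∀ᶠ w in 𝓝[≠] z, F w = g w := by
        filter_upwards [nhdsNE_le_cofinite z hfg] with w hw
        by_cases hwS : w ∈ S
        · exact hFg w hwS
        · rw [hFf w hwS, hw]
      rw [eventually_nhdsWithin_iff] at h1
      filter_upwards [h1] with w hw
      by_cases hwz : w = z
      · rw [hwz, hFg z hz]
      · exact hw hwz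
    · refine (hf z hz).congr_of_eventuallyEq ?_
      filter_upwards [hS.isClosed.isOpen_compl.mem_nhds hz] with w hw using hFf w hw
  have hlimF : Tendsto F (cocompact ℂ) (𝓝 c) := by
    refine hlim.congr' ?_
    filter_upwards [cocompact_le_cofinite hS.compl_mem_cofinite] with w hw using (hFf w hw).symm
  intro z hz
  rw [← hFf z hz]
  exact hF.apply_eq_of_tendsto_cocompact z hlimF

lemma loop_eq_one_of_regular {g : Loop} (hg : ∀ z, LoopRegularAt g z)
    (hlim : Tendsto (evalAt g) (cocompact ℂ) (𝓝 1)) : g = 1 := by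
  refine loop_eq_of_eventually (Eventually.of_forall fun z => ?_)
  rw [evalAt_one]
  ext i j
  have hd : Differentiable ℂ (value (g i j)) := fun z => (hg z i j).differentiableAt
  exact hd.apply_eq_of_tendsto_cocompact z (tendsto_pi_nhds.1 (tendsto_pi_nhds.1 hlim i) j)

lemma differentiableAt_of_apply {f : ℂ → V} {z : ℂ}
    (h : ∀ i, DifferentiableAt ℂ (fun w => f w i) z) : DifferentiableAt ℂ f z :=
  (differentiableAt_piLp 2).2 h

lemma differentiableAt_act {g : Loop} {z : ℂ} (hg : LoopRegularAt g z) {x : ℂ → V}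
    (hx : DifferentiableAt ℂ x z) : DifferentiableAt ℂ (fun w => act (evalAt g w) (x w)) z := by
  refine differentiableAt_of_apply fun i => ?_
  simp only [act_apply]
  exact DifferentiableAt.fun_sum fun j _ => (hg i j).differentiableAt.mul
    ((differentiableAt_piLp 2).1 hx j)

lemma differentiableAt_octProd {x y : ℂ → V} {z : ℂ} (hx : DifferentiableAt ℂ x z)
    (hy : DifferentiableAt ℂ y z) : DifferentiableAt ℂ (fun w => octProd (x w) (y w)) z := by
  have hx' := (differentiableAt_piLp 2).1 hx
  have hy' := (differentiableAt_piLp 2).1 hy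
  refine differentiableAt_of_apply fun i => ?_
  fin_cases i <;> simp [octProd] <;> fun_prop

@[fun_prop]
lemma _root_.Continuous.octProd {X : Type*} [TopologicalSpace X] {x y : X → V} (hx : Continuous x)
    (hy : Continuous y) : Continuous fun i => octProd (x i) (y i) := by
  refine (PiLp.continuous_toLp 2 _).comp (continuous_pi fun i => ?_)
  fin_cases i <;> simp <;> fun_prop

lemma PreservesOct.mul {A B : Matrix (Fin 7) (Fin 7) ℂ} (hA : PreservesOct A)
    (hB : PreservesOct B) : PreservesOct (A * B) := fun x y => by
  simp only [act_mul, hA _ _, hB _ _]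

lemma PreservesOct.transpose {A : Matrix (Fin 7) (Fin 7) ℂ} (hA : PreservesOct A)
    (ho : A.transpose * A = 1) : PreservesOct A.transpose := fun x y => by
  have ho' := mul_eq_one_comm.1 ho
  rw [← act_one (octProd (act _ x) _), ← ho, act_mul, ← hA, ← act_mul, ← act_mul, ho', act_one,
    act_one]

/-- The product of imaginary octonions transported by `A`. -/
def octConj (A : Matrix (Fin 7) (Fin 7) ℂ) (x y : V) : V :=
  act A (octProd (act A.transpose x) (act A.transpose y))

lemma octConj_mul {A B : Matrix (Fin 7) (Fin 7) ℂ} (hB : PreservesOct B)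
    (ho : B.transpose * B = 1) (x y : V) : octConj (A * B) x y = octConj A x y := by
  have hBt := hB.transpose ho
  simp only [octConj, Matrix.transpose_mul, act_mul]
  rw [hBt, ← act_mul B, mul_eq_one_comm.1 ho, act_one]

lemma preservesOct_of_octConj {A : Matrix (Fin 7) (Fin 7) ℂ} (ho : A.transpose * A = 1)
    (h : ∀ x y, octConj A x y = octProd x y) : PreservesOct A := fun x y => by
  rw [← h, octConj, ← act_mul, ← act_mul, ho, act_one, act_one]

/-- Right multiplication by automorphisms does not change the transported product, so g'h = h'g
shows that g' and h' transport it to the same product at almost every point. One side is holomorphic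
off {α, ᾱ}, the other off {β, β̄}, and the limit at ∞ is the original product. By Liouville it is
constant. -/
lemma GoodLoop.preservesOct {α β : ℂ} (hαβ : α ≠ β) (hαβ' : α ≠ starRingEnd ℂ β)
    {g g' h h' : Loop} (hg' : GoodLoop α g') (hh' : GoodLoop β h') (hg : GoodLoop α g)
    (hh : GoodLoop β h) (heq : g' * h = h' * g)
    (hgo : ∀ᶠ z in cofinite, PreservesOct (evalAt g z))
    (hho : ∀ᶠ z in cofinite, PreservesOct (evalAt h z)) :
    ∀ᶠ z in cofinite, PreservesOct (evalAt g' z) := by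
  have hfin : ({α, starRingEnd ℂ α} : Set ℂ).Finite := by simp
  have hdisj : Disjoint ({α, starRingEnd ℂ α} : Set ℂ) {β, starRingEnd ℂ β} := by
    rw [Set.disjoint_left]
    rintro z (rfl | rfl)
    · simp [hαβ, hαβ']
    · simp [ne_conj_of_ne hαβ', ne_conj_conj_of_ne hαβ]
  have hdiff : ∀ {γ : ℂ} {k : Loop}, GoodLoop γ k → ∀ x y, ∀ z ∉ ({γ, starRingEnd ℂ γ} : Set ℂ),
      DifferentiableAt ℂ (fun w => octConj (evalAt k w) x y) z := by
    intro γ k hk x y z hz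
    simp only [Set.mem_insert_iff, Set.mem_singleton_iff, not_or] at hz
    have hr := hk.regular z hz.1 hz.2
    refine differentiableAt_act hr (differentiableAt_octProd ?_ ?_)
    · exact differentiableAt_act hr.transpose (differentiableAt_const x)
    · exact differentiableAt_act hr.transpose (differentiableAt_const y)
  have hagree : ∀ x y, ∀ᶠ z in cofinite,
      octConj (evalAt g' z) x y = octConj (evalAt h' z) x y := by
    intro x y
    filter_upwards [eventually_evalAt_mul g' h, eventually_evalAt_mul h' g, hgo, hho,
      eventually_loopRegularAt g, eventually_loopRegularAt h] with z h1 h2 h3 h4 h5 h6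
    rw [heq] at h1
    rw [← octConj_mul h4 (evalAt_transpose_mul hh.orth h6), ← h1, h2,
      octConj_mul h3 (evalAt_transpose_mul hg.orth h5)]
  have hlim : ∀ x y, Tendsto (fun z => octConj (evalAt g' z) x y) (cocompact ℂ)
      (𝓝 (octProd x y)) := by
    intro x y
    have hc : Continuous fun A => octConj A x y := by
      unfold octConj
      fun_prop
    have := (hc.tendsto 1).comp hg'.tendsto_one
    simpa [octConj, act_one, Function.comp_def] using this
  have hmain := fun x y => eq_of_tendsto_cocompact_of_glue hfin hdisj (hdiff hg' x y)
    (hdiff hh' x y) (hagree x y) (hlim x y)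
  filter_upwards [hfin.compl_mem_cofinite, eventually_loopRegularAt g'] with z hz hr
  exact preservesOct_of_octConj (evalAt_transpose_mul hg'.orth hr) fun x y => hmain x y z hz

lemma IsG2Pair.preservesOct (α : ℂ) {L K : Submodule ℂ V} (h : IsG2Pair L K) :
    ∀ᶠ z in cofinite, PreservesOct (evalAt (pairLoop α L K) z) := by
  obtain ⟨l, w, a, rfl, rfl, hll, hww, hlw, hlw', hl1, hw1, ho⟩ := h.exists_span
  have hne : ∀ᶠ z in cofinite, (z - α) / (z - starRingEnd ℂ α) + a * starRingEnd ℂ a ≠ 0 := by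
    set r := a * starRingEnd ℂ a with hr
    have hr0 : 1 + r ≠ 0 := by
      rw [hr, Complex.mul_conj]
      exact_mod_cast (add_pos_of_pos_of_nonneg one_pos (Complex.normSq_nonneg a)).ne'
    -- The excluded point is the solution of t = -r.
    filter_upwards [eventually_cofinite_ne ((α + r * starRingEnd ℂ α) / (1 + r)),
      eventually_cofinite_ne (starRingEnd ℂ α)] with z hz hz' h0
    have hz'' : z - starRingEnd ℂ α ≠ 0 := sub_ne_zero.2 hz'
    apply hz
    field_simp at h0 ⊢
    linear_combination h0
  filter_upwards [eventually_evalAt_pairLoop α (ℂ ∙ l) (ℂ ∙ (a • conjMap l + w)), hne,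
    eventually_cofinite_ne α, eventually_cofinite_ne (starRingEnd ℂ α)] with z h1 h2 h3 h4
  rw [h1]
  exact preservesOct_scaling_mul_scaling hll hww hlw hlw' hl1 hw1 ho
    (div_ne_zero (sub_ne_zero.2 h3) (sub_ne_zero.2 h4)) h2

/-- From p_{α,L',K'} = h' p_{α,L,K} h⁻¹ with h and h' invertible at α, the coefficients of t⁻² and
t⁻¹ are multiplied by h'(α) on the left and h(α)⁻¹ on the right. Thus the double pole stays absent
and the residue stays nonzero. -/
lemma IsG2Pair.of_mul_eq {α β : ℂ} (hα : α ≠ starRingEnd ℂ α) (hαβ : α ≠ β)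
    (hαβ' : α ≠ starRingEnd ℂ β) {L K L' K' : Submodule ℂ V} {h h' : Loop} (hLK : IsG2Pair L K)
    (hL' : IsIsotropicLine L') (hK' : IsIsotropicLine K') (hh : GoodLoop β h)
    (hh' : GoodLoop β h') (hho : ∀ᶠ z in cofinite, PreservesOct (evalAt h z))
    (heq : pairLoop α L' K' * h = h' * pairLoop α L K) : IsG2Pair L' K' := by
  have hg := goodLoop_pairLoop α hLK.isotropicLine_left hLK.isotropicLine_right
  have hg' := goodLoop_pairLoop α hL' hK'
  have hpres := hg'.preservesOct hαβ hαβ' hh' hg hh heq (hLK.preservesOct α) hho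
  obtain ⟨hQ, hR⟩ := hLK.pairResidue_ne_zero
  have hr := hh.regular α hαβ hαβ'
  have hr' := hh'.regular α hαβ hαβ'
  have heq' : pairLoop α L' K' = h' * pairLoop α L K * h.transpose := by
    rw [← heq, Matrix.mul_assoc, hh.mul_transpose_self, Matrix.mul_one]
  have hev : ∀ᶠ z in 𝓝[≠] α, ∀ c : ℂ, evalAt h' z * (c • evalAt (pairLoop α L K) z) *
      evalAt h.transpose z = c • evalAt (pairLoop α L' K') z := by
    filter_upwards [nhdsNE_le_cofinite α (eventually_evalAt_mul (h' * pairLoop α L K) h.transpose),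
      nhdsNE_le_cofinite α (eventually_evalAt_mul h' (pairLoop α L K))] with z h1 h2 c
    rw [heq', h1, h2, Matrix.mul_smul, Matrix.smul_mul]
  have hQ' : projMat (conjSub L') * projMat (conjSub K') = 0 := by
    have h1 := (hr'.tendsto.mul (tendsto_sq_smul_pairLoop hα L K)).mul hr.transpose.tendsto
    rw [hQ, mul_zero, zero_mul] at h1
    refine tendsto_nhds_unique (tendsto_sq_smul_pairLoop hα L' K') (h1.congr' ?_)
    filter_upwards [hev] with z hz using hz _
  have hR' : pairResidue L' K' =
      evalAt h' α * pairResidue L K * evalAt h.transpose α := by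
    have h1 := (hr'.tendsto.mul (tendsto_smul_pairLoop hα hQ)).mul hr.transpose.tendsto
    refine tendsto_nhds_unique (tendsto_smul_pairLoop hα hQ') (h1.congr' ?_)
    filter_upwards [hev] with z hz using hz _
  refine isG2Pair_of_pairResidue hL' hK' hQ' ?_ ?_
  · intro h0
    apply hR
    have e1 := evalAt_transpose_mul hh.orth hr
    have e2 := evalAt_transpose_mul hh'.orth hr'
    calc pairResidue L K = ((evalAt h' α).transpose * evalAt h' α) * pairResidue L K *
          ((evalAt h α).transpose * evalAt h α) := by
            rw [e1, e2, Matrix.one_mul, Matrix.mul_one]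
      _ = (evalAt h' α).transpose * pairResidue L' K' * evalAt h α := by
            rw [hR', evalAt_transpose]
            simp only [Matrix.mul_assoc]
      _ = 0 := by rw [h0, Matrix.mul_zero, Matrix.zero_mul]
  · intro x y
    have hlim := tendsto_smul_pairLoop hα hQ'
    have hc : Continuous fun A => octProd (act A x) (act A y) := by fun_prop
    have hc' : Continuous fun A => act A (octProd x y) := by fun_prop
    have h1 := (hc.tendsto _).comp hlim
    have h2 := (hc'.tendsto _).comp (tendsto_sq_smul_pairLoop hα L' K')
    have h3 : act (0 : Matrix (Fin 7) (Fin 7) ℂ) (octProd x y) = 0 := by simp [act]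
    rw [hQ', h3] at h2
    -- Multiply gx · gy = g(x · y) by t² and let z → α. The left side tends to the product of the
    -- residue's values; the right side tends to the absent double-pole coefficient applied to x ·
    -- y, which is 0.
    refine tendsto_nhds_unique h1 (h2.congr' ?_)
    filter_upwards [nhdsNE_le_cofinite α hpres] with z hz
    simp only [Function.comp_apply, smul_act, octProd_smul_left, octProd_smul_right, hz x y,
      smul_smul, sq]

/-! ### Dressing of pairs and permutability. -/

/-- Dressing a pair of lines with the values at `α` of a `G₂`-loop without pole at `α`. -/
lemma IsG2Pair.dress {α β : ℂ} (hα : α.im ≠ 0) (hαβ : α ≠ β) (hαβ' : α ≠ starRingEnd ℂ β)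
    {L K K' L' : Submodule ℂ V} {h : Loop} (hLK : IsG2Pair L K) (hh : GoodLoop β h)
    (hho : ∀ᶠ z in cofinite, PreservesOct (evalAt h z)) (hK' : K' = image (evalAt h α) K)
    (hL' : L' = image (evalAt (G2Loop.dress α K' h) α) L) :
    IsHolomorphicAt (G2Loop.dress α K' h) α ∧ IsG2Pair L' K' ∧
      ∃ h', GoodLoop β h' ∧ pairLoop α L' K' * h = h' * pairLoop α L K := by
  have hαα : α ≠ starRingEnd ℂ α := fun h' => hα (Complex.conj_eq_iff_im.1 h'.symm)
  have hgK := goodLoop_simpleLoop α hLK.isotropicLine_right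
  have hgL := goodLoop_simpleLoop α hLK.isotropicLine_left
  obtain ⟨hKi, hd⟩ := hh.dressed hα hαβ hαβ' hLK.isotropicLine_right
  rw [← hK'] at hKi hd
  have hback : image (evalAt h α)⁻¹ K' = K := by
    obtain ⟨k, rfl, -, -⟩ := hLK.isotropicLine_right.exists_span
    have ho := evalAt_transpose_mul hh.orth (hh.regular α hαβ hαβ')
    rw [hK', image_span, image_span, ← act_mul, Matrix.inv_eq_left_inv ho, ho, act_one]
  have hdress : G2Loop.dress α K' h = simpleLoop α K' * h * (simpleLoop α K).transpose := by
    rw [G2Loop.dress, hback, Matrix.inv_eq_left_inv hgK.orth]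
  rw [← hdress] at hd
  -- The loop dressed by K is again good for β, so it can be dressed a second time, with L.
  obtain ⟨hLi, hd'⟩ := hd.dressed hα hαβ hαβ' hLK.isotropicLine_left
  rw [← hL'] at hLi hd'
  have heq : pairLoop α L' K' * h = (simpleLoop α L' * G2Loop.dress α K' h *
      (simpleLoop α L).transpose) * pairLoop α L K := by
    calc pairLoop α L' K' * h = simpleLoop α L' * (simpleLoop α K' * h * 1) := by
          rw [pairLoop, Matrix.mul_one, Matrix.mul_assoc]
      _ = simpleLoop α L' * G2Loop.dress α K' h * 1 * simpleLoop α K := by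
          rw [Matrix.mul_one (simpleLoop α L' * _), ← hgK.orth, hdress]
          simp only [Matrix.mul_assoc]
      _ = _ := by
          rw [← hgL.orth, pairLoop]
          simp only [Matrix.mul_assoc]
  exact ⟨hd.isHolomorphicAt hαβ hαβ',
    hLK.of_mul_eq hαα hαβ hαβ' hLi hKi hh hd' hho heq, _, hd', heq⟩

/-- Eliminating g gives k h'⁻¹ = k' g'⁻¹. Poles of the left side lie in {β, β̄}, those of the right
side in {α, ᾱ}; these sets are disjoint, so the loop is entire with limit 1 at ∞. -/
lemma eq_of_goodLoop_mul_eq {α β : ℂ} (hαβ : α ≠ β) (hαβ' : α ≠ starRingEnd ℂ β)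
    {g g' h h' k k' : Loop} (hg' : GoodLoop α g') (hh : GoodLoop β h) (hh' : GoodLoop β h')
    (hk : GoodLoop β k) (hk' : GoodLoop α k')
    (h1 : g' * h = h' * g) (h2 : k * g = k' * h) : k = h' := by
  have hc : k * h'.transpose = k' * g'.transpose := by
    have e1 : g = h'.transpose * (g' * h) := by
      rw [h1, ← Matrix.mul_assoc, hh'.orth, Matrix.one_mul]
    have e2 : k * h'.transpose * g' * h = k' * h := by
      rw [← h2, e1]
      simp only [Matrix.mul_assoc]
    have e3 := congrArg (fun M => M * h.transpose * g'.transpose) e2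
    simpa only [Matrix.mul_assoc, hh.mul_transpose_self, hg'.mul_transpose_self, Matrix.mul_one,
      ← Matrix.mul_assoc h h.transpose, Matrix.one_mul] using e3
  have hgood := hk.mul hh'.transpose
  have hone : k * h'.transpose = 1 := by
    refine loop_eq_one_of_regular (fun z => ?_) hgood.tendsto_one
    by_cases hz : z ≠ β ∧ z ≠ starRingEnd ℂ β
    · exact hgood.regular z hz.1 hz.2
    · rw [hc]
      have hz' : z = β ∨ z = starRingEnd ℂ β := by tauto
      refine (hk'.mul hg'.transpose).regular z ?_ ?_
      · rintro rfl
        tauto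
      · rintro rfl
        rcases hz' with hz' | hz'
        · exact ne_conj_of_ne hαβ' hz'
        · exact ne_conj_conj_of_ne hαβ hz'
  rw [← Matrix.mul_one k, ← hh'.orth, ← Matrix.mul_assoc, hone, Matrix.one_mul]

end G2Loop

end


theorem mainTheorem8 (α β : ℂ) (hα : α.im ≠ 0) (hβ : β.im ≠ 0)
    (hαβ : α ≠ β) (hαβ' : α ≠ starRingEnd ℂ β)
    (L K M N : Submodule ℂ G2Loop.V)
    (hLK : G2Loop.IsG2Pair L K) (hMN : G2Loop.IsG2Pair M N) :
    -- the loops that are evaluated below are holomorphic at the point in question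
    G2Loop.IsHolomorphicAt (G2Loop.pairLoop β M N) α ∧
    G2Loop.IsHolomorphicAt (G2Loop.pairLoop α L K) β ∧
    ∀ K' L' N' M' : Submodule ℂ G2Loop.V,
      K' = G2Loop.image (G2Loop.evalAt (G2Loop.pairLoop β M N) α) K →
      L' = G2Loop.image
        (G2Loop.evalAt (G2Loop.dress α K' (G2Loop.pairLoop β M N)) α) L →
      N' = G2Loop.image (G2Loop.evalAt (G2Loop.pairLoop α L K) β) N →
      M' = G2Loop.image
        (G2Loop.evalAt (G2Loop.dress β N' (G2Loop.pairLoop α L K)) β) M →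
      G2Loop.IsHolomorphicAt (G2Loop.dress α K' (G2Loop.pairLoop β M N)) α ∧
      G2Loop.IsHolomorphicAt (G2Loop.dress β N' (G2Loop.pairLoop α L K)) β ∧
      G2Loop.IsG2Pair L' K' ∧ G2Loop.IsG2Pair M' N' ∧
      G2Loop.pairLoop α L' K' * G2Loop.pairLoop β M N =
        G2Loop.pairLoop β M' N' * G2Loop.pairLoop α L K := by
  have hβα' : β ≠ starRingEnd ℂ α := (G2Loop.ne_conj_of_ne hαβ').symm
  have hg := G2Loop.goodLoop_pairLoop α hLK.isotropicLine_left hLK.isotropicLine_right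
  have hh := G2Loop.goodLoop_pairLoop β hMN.isotropicLine_left hMN.isotropicLine_right
  refine ⟨hh.isHolomorphicAt hαβ hαβ', hg.isHolomorphicAt hαβ.symm hβα', ?_⟩
  intro K' L' N' M' hK' hL' hN' hM'
  obtain ⟨h1, h2, h', hh', heq⟩ := hLK.dress hα hαβ hαβ' hh (hMN.preservesOct β) hK' hL'
  obtain ⟨k1, k2, k', hk', keq⟩ := hMN.dress hβ hαβ.symm hβα' hg (hLK.preservesOct α) hN' hM'
  refine ⟨h1, k1, h2, k2, ?_⟩
  -- The first dressing yields only some good left factor h'; comparison with the second dressing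
  -- identifies it as p_{β,M',N'}.
  rw [heq, G2Loop.eq_of_goodLoop_mul_eq hαβ hαβ'
    (G2Loop.goodLoop_pairLoop α h2.isotropicLine_left h2.isotropicLine_right) hh hh'
    (G2Loop.goodLoop_pairLoop β k2.isotropicLine_left k2.isotropicLine_right) hk' heq keq]
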